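/- Let $\mathfrak h$ be a complex Hilbert space, let $\mathfrak C_1^{\rm sa}$ be the real Banach space of self-adjoint trace-class operators on $\mathfrak h$ with the trace norm $\|u\|={\rm Tr}\,|u|$, and write $u\ge 0$ if $(ux,x)\ge 0$ for all $x\in\mathfrak h$. For a subspace $D\subset\mathfrak C_1^{\rm sa}$ put $D^+=\{u\in D:u\ge0\}$. A linear map $A\colon D\to\mathfrak C_1^{\rm sa}$ is positivity preserving if $Au\ge0$ for all $u\in D^+$; for two linear maps $A,B\colon D\to\mathfrak C_1^{\rm sa}$ write $A\le B$ if $B-A$ is positivity preserving. A semigroup $(S_t)_{t>0}$ is positivity preserving if every $S_t$ is. Let $-H$ be the generator of a positivity preserving contraction $C_0$-semigroup on $\mathfrak C_1^{\rm sa}$. Let $K\colon D(H)\to\mathfrak C_1^{\rm sa}$ be a positivity preserving (linear) operator with ${\rm Tr}(Ku)\le{\rm Tr}(Hu)$ for all $u\in D(H)^+$. Let $(K_\alpha)_{\alpha\in J}$ be a functional regularisation of $K$, that is, a net of linear operators $K_\alpha\colon D(H)\to\mathfrak C_1^{\rm sa}$ such that (I) $K_\alpha$ is positivity preserving for all $\alpha\in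 J$; (II) for all $\alpha\in J$ there are $a_\alpha\in[0,\infty)$ and $b_\alpha\in[0,1)$ with ${\rm Tr}(K_\alpha u)\le a_\alpha{\rm Tr}\,u+b_\alpha{\rm Tr}(Hu)$ for all $u\in D(H)^+$; (III) $K_\alpha\le K_\beta\le K$ for all $\alpha,\beta\in J$ with $\alpha\le\beta$; (IV) for all $u\in D(H)^+$ there is a dense subspace $V$ of $\mathfrak h$ with $\lim_\alpha((K_\alpha u)x,x)=((Ku)x,x)$ for all $x\in V$. Set $L_\alpha=H-K_\alpha$, with domain $D(H)$. Then the following hold. (a) For all $\alpha\in J$ the operator $L_\alpha$ is $m$-accretive (for every $\lambda>0$ one has $\|(\lambda I+L_\alpha)u\|\ge\lambda\|u\|$ for all $u\in D(H)$, and $\lambda I+L_\alpha$ is surjective), and $-L_\alpha$ generates a positivity preserving contraction $C_0$-semigroup $(T^\alpha_t)_{t>0}$ on $\mathfrak C_1^{\rm sa}$. (b) If $\alpha\le\beta$, then $T^\alpha_t\le T^\beta_t$ for all $t>0$. (c) For all $t>0$ and $u\in\mathfrak C_1^{\rm sa}$ the limit $T_tu=\lim_\alpha T^\alpha_tu$ exists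 in $\mathfrak C_1^{\rm sa}$. (d) $(T_t)_{t>0}$ is a positivity preserving contraction $C_0$-semigroup on $\mathfrak C_1^{\rm sa}$. Let $-L$ be the generator of $(T_t)_{t>0}$. (e) For all $\lambda>0$ the bounded inverses $(\lambda I+L_\alpha)^{-1}$ $(\alpha\in J)$ and $(\lambda I+L)^{-1}$ exist and $\lim_\alpha(\lambda I+L_\alpha)^{-1}u=(\lambda I+L)^{-1}u$ in trace norm for all $u\in\mathfrak C_1^{\rm sa}$. (f) $L$ is an extension of $H-K$ (with domain $D(H)$). -/

import Mathlib

open Filter Topology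
open scoped ENNReal InnerProductSpace

set_option linter.unusedSectionVars false
set_option linter.unusedSimpArgs false

noncomputable section

namespace KatoReg

/-! ## The trace of a positive operator -/

section PositiveTrace

variable {h : Type*} [NormedAddCommGroup h] [InnerProductSpace ℂ h] [CompleteSpace h]

/-- The sum `∑ i, (p bᵢ, bᵢ)` in `[0, ∞]`, for a positive operator `p` and an orthonormal
basis `b`. -/
def traceAlong {ι : Type*} (b : HilbertBasis ι ℂ h) (p : h →L[ℂ] h) : ℝ≥0∞ :=
  ∑' i, ENNReal.ofReal (inner ℂ (b i) (p (b i))).re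

/-- A fixed orthonormal basis of `h`. Nothing below depends on the choice. -/
def stdBasis (h : Type*) [NormedAddCommGroup h] [InnerProductSpace ℂ h] [CompleteSpace h] :
    HilbertBasis (exists_hilbertBasis ℂ h).choose ℂ h :=
  (exists_hilbertBasis ℂ h).choose_spec.choose

/-- The trace, in `[0, ∞]`, of a positive operator. -/
def posTrace (p : h →L[ℂ] h) : ℝ≥0∞ := traceAlong (stdBasis h) p

theorem inner_re_nonneg {p : h →L[ℂ] h} (hp : 0 ≤ p) (x : h) : 0 ≤ (inner ℂ x (p x)).re :=
  ((ContinuousLinearMap.nonneg_iff_isPositive p).1 hp).re_inner_nonneg_right x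

theorem parseval {ι : Type*} (b : HilbertBasis ι ℂ h) (x : h) :
    ENNReal.ofReal (‖x‖ ^ 2) = ∑' i, ENNReal.ofReal (‖inner ℂ (b i) x‖ ^ 2) := by
  have h1 := b.hasSum_inner_mul_inner x x
  have h2 : HasSum (fun i => ‖inner ℂ (b i) x‖ ^ 2) (‖x‖ ^ 2) := by
    have h3 := Complex.hasSum_re h1
    convert h3 using 1
    · ext i
      rw [← inner_conj_symm x (b i), mul_comm, Complex.mul_conj, Complex.ofReal_re,
        Complex.normSq_eq_norm_sq]
    · rw [inner_self_eq_norm_sq_to_K]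
      norm_cast
  rw [← h2.tsum_eq, ENNReal.ofReal_tsum_of_nonneg (fun i => by positivity) h2.summable]

theorem exists_sqrt {p : h →L[ℂ] h} (hp : 0 ≤ p) : ∃ s : h →L[ℂ] h,
    (∀ x y, inner ℂ (s x) y = inner ℂ x (s y)) ∧ p = s * s ∧
    ∀ x, (inner ℂ x (p x)).re = ‖s x‖ ^ 2 := by
  have hs : (CFC.sqrt p).IsPositive :=
    (ContinuousLinearMap.nonneg_iff_isPositive _).1 (CFC.sqrt_nonneg p)
  have hpp : CFC.sqrt p * CFC.sqrt p = p := CFC.sqrt_mul_sqrt_self p hp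
  have hsym : ∀ x y, inner ℂ (CFC.sqrt p x) y = inner ℂ x (CFC.sqrt p y) :=
    fun x y => hs.inner_left_eq_inner_right x y
  refine ⟨CFC.sqrt p, hsym, hpp.symm, fun x => ?_⟩
  have : p x = CFC.sqrt p (CFC.sqrt p x) := by
    conv_lhs => rw [← hpp]
    rfl
  rw [this, ← hsym, inner_self_eq_norm_sq_to_K]
  norm_cast

/-- The trace of a positive operator does not depend on the orthonormal basis. -/
theorem traceAlong_eq {ι κ : Type*} (b : HilbertBasis ι ℂ h) (c : HilbertBasis κ ℂ h)
    {p : h →L[ℂ] h} (hp : 0 ≤ p) : traceAlong b p = traceAlong c p := by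
  obtain ⟨s, hs, -, hn⟩ := exists_sqrt hp
  unfold traceAlong
  simp_rw [hn]
  calc ∑' i, ENNReal.ofReal (‖s (b i)‖ ^ 2)
      = ∑' i, ∑' j, ENNReal.ofReal (‖inner ℂ (c j) (s (b i))‖ ^ 2) := by
        simp_rw [parseval c]
    _ = ∑' j, ∑' i, ENNReal.ofReal (‖inner ℂ (c j) (s (b i))‖ ^ 2) := ENNReal.tsum_comm
    _ = ∑' j, ENNReal.ofReal (‖s (c j)‖ ^ 2) := by
        refine tsum_congr fun j => ?_
        rw [parseval b (s (c j))]
        refine tsum_congr fun i => ?_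
        rw [← hs, ← inner_conj_symm, RCLike.norm_conj]

theorem traceAlong_add {ι : Type*} (b : HilbertBasis ι ℂ h) {p q : h →L[ℂ] h}
    (hp : 0 ≤ p) (hq : 0 ≤ q) : traceAlong b (p + q) = traceAlong b p + traceAlong b q := by
  unfold traceAlong
  rw [← ENNReal.tsum_add]
  refine tsum_congr fun i => ?_
  rw [← ENNReal.ofReal_add (inner_re_nonneg hp _) (inner_re_nonneg hq _)]
  simp [inner_add_right]

theorem eq_zero_of_posTrace {p : h →L[ℂ] h} (hp : 0 ≤ p) (h0 : posTrace p = 0) : p = 0 := by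
  obtain ⟨s, -, rfl, hn⟩ := exists_sqrt hp
  have h1 : ∀ i, s (stdBasis h i) = 0 := by
    intro i
    have := ENNReal.tsum_eq_zero.1 h0 i
    rw [hn, ENNReal.ofReal_eq_zero] at this
    have h2 : ‖s (stdBasis h i)‖ ^ 2 = 0 := le_antisymm this (by positivity)
    simpa using h2
  have h3 : s = 0 := by
    refine ContinuousLinearMap.ext_on (s := Set.range (stdBasis h)) ?_ ?_
    · exact (Submodule.dense_iff_topologicalClosure_eq_top).2 (stdBasis h).dense_span
    · rintro _ ⟨i, rfl⟩
      simpa using h1 i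
  simp [h3]

theorem abs_inner_re_le {u : h →L[ℂ] h} (hu : IsSelfAdjoint u) (x : h) :
    |(inner ℂ x (u x)).re| ≤ (inner ℂ x (CFC.abs u x)).re := by
  have h1 : CFC.abs u = u⁺ + u⁻ := (CFC.posPart_add_negPart u hu).symm
  have h2 : u = u⁺ - u⁻ := (CFC.posPart_sub_negPart u hu).symm
  have hp := inner_re_nonneg (CFC.posPart_nonneg u) x
  have hm := inner_re_nonneg (CFC.negPart_nonneg u) x
  have e1 : (inner ℂ x (CFC.abs u x)).re = (inner ℂ x (u⁺ x)).re + (inner ℂ x (u⁻ x)).re := by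
    rw [h1]; simp [inner_add_right]
  have e2 : (inner ℂ x (u x)).re = (inner ℂ x (u⁺ x)).re - (inner ℂ x (u⁻ x)).re := by
    conv_lhs => rw [h2]
    simp [inner_sub_right]
  rw [e1, e2, abs_le]
  constructor <;> linarith

/-- An orthonormal basis adapted to the splitting `u = u⁺ - u⁻`. -/
theorem exists_adapted_basis (u : h →L[ℂ] h) : ∃ (w : Set h) (b : HilbertBasis w ℂ h),
    ∀ i, u⁺ (b i) = 0 ∨ u⁻ (b i) = 0 := by
  set M : Submodule ℂ h := LinearMap.ker (u⁻ : h →L[ℂ] h).toLinearMap with hM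
  have hMc : IsClosed (M : Set h) := ContinuousLinearMap.isClosed_ker u⁻
  have : CompleteSpace M := hMc.completeSpace_coe
  obtain ⟨v, c, hc⟩ := exists_hilbertBasis ℂ M
  have hon : Orthonormal ℂ (fun i : v => ((c i : M) : h)) :=
    c.orthonormal.comp_linearIsometry M.subtypeₗᵢ
  obtain ⟨w, b, hsw, hb⟩ := hon.toSubtypeRange.exists_hilbertBasis_extension
  refine ⟨w, b, fun i => ?_⟩
  by_cases hi : (i : h) ∈ Set.range (fun i : v => ((c i : M) : h))
  · right
    obtain ⟨j, hj⟩ := hi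
    have : b i = ((c j : M) : h) := by rw [hb]; exact hj.symm
    rw [this]
    exact (c j).2
  · left
    have hbi : b i ∈ Mᗮ := by
      have h1 : ∀ j, inner ℂ ((c j : M) : h) (b i) = 0 := by
        intro j
        have hjw : ((c j : M) : h) ∈ w := hsw ⟨j, rfl⟩
        have h2 := b.orthonormal.2 (i := ⟨_, hjw⟩) (j := i) (fun he => hi (by
          rw [← he]; exact ⟨j, rfl⟩))
        rw [hb] at h2 ⊢
        exact h2
      have h3 : M.orthogonalProjectionOnto (b i) = 0 := by
        have h5 : ∀ j, inner ℂ (c j) (M.orthogonalProjectionOnto (b i)) = 0 := by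
          intro j
          rw [← h1 j]
          simp
        have h6 : c.repr (M.orthogonalProjectionOnto (b i)) = 0 := by
          ext j
          rw [c.repr_apply_apply]
          simpa using h5 j
        simpa using h6
      rwa [Submodule.orthogonalProjectionOnto_eq_zero_iff] at h3
    have hz : ∀ y, inner ℂ y (u⁺ (b i)) = 0 := by
      intro y
      have hpos : (u⁺).IsPositive :=
        (ContinuousLinearMap.nonneg_iff_isPositive _).1 (CFC.posPart_nonneg u)
      rw [← hpos.inner_left_eq_inner_right]
      apply hbi
      have : (u⁻ * u⁺) y = 0 := by rw [CFC.negPart_mul_posPart]; rfl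
      exact this
    exact inner_self_eq_zero.1 (hz _)

/-- The triangle inequality for the trace norm of self-adjoint operators. -/
theorem posTrace_abs_add_le {u v : h →L[ℂ] h} (hu : IsSelfAdjoint u) (hv : IsSelfAdjoint v) :
    posTrace (CFC.abs (u + v)) ≤ posTrace (CFC.abs u) + posTrace (CFC.abs v) := by
  obtain ⟨w, b, hb⟩ := exists_adapted_basis (u + v)
  have huv := hu.add hv
  unfold posTrace
  rw [traceAlong_eq _ b (CFC.abs_nonneg _), traceAlong_eq _ b (CFC.abs_nonneg u),
    traceAlong_eq _ b (CFC.abs_nonneg v), ← traceAlong_add b (CFC.abs_nonneg u) (CFC.abs_nonneg v)]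
  unfold traceAlong
  refine ENNReal.tsum_le_tsum fun i => ENNReal.ofReal_le_ofReal ?_
  have h1 := abs_inner_re_le hu (b i)
  have h2 := abs_inner_re_le hv (b i)
  have e1 : CFC.abs (u + v) = (u + v)⁺ + (u + v)⁻ := (CFC.posPart_add_negPart _ huv).symm
  have e2 : u + v = (u + v)⁺ - (u + v)⁻ := (CFC.posPart_sub_negPart _ huv).symm
  have e3 : (inner ℂ (b i) ((u + v) (b i))).re
      = (inner ℂ (b i) (u (b i))).re + (inner ℂ (b i) (v (b i))).re := by
    simp [inner_add_right]
  have e4 : (inner ℂ (b i) ((u + v) (b i))).re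
      = (inner ℂ (b i) ((u + v)⁺ (b i))).re - (inner ℂ (b i) ((u + v)⁻ (b i))).re := by
    conv_lhs => rw [e2]
    simp [inner_sub_right]
  have e5 : (inner ℂ (b i) (CFC.abs (u + v) (b i))).re
      = (inner ℂ (b i) ((u + v)⁺ (b i))).re + (inner ℂ (b i) ((u + v)⁻ (b i))).re := by
    rw [e1]; simp [inner_add_right]
  have e6 : (inner ℂ (b i) ((CFC.abs u + CFC.abs v) (b i))).re
      = (inner ℂ (b i) (CFC.abs u (b i))).re + (inner ℂ (b i) (CFC.abs v (b i))).re := by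
    simp [inner_add_right]
  rw [abs_le] at h1 h2
  rcases hb i with hi | hi <;> simp only [hi, inner_zero_right, Complex.zero_re] at e4 e5 <;>
    linarith [h1.1, h1.2, h2.1, h2.2]

theorem posTrace_abs_smul (r : ℝ) (u : h →L[ℂ] h) :
    posTrace (CFC.abs (r • u)) = ENNReal.ofReal |r| * posTrace (CFC.abs u) := by
  rw [CFC.abs_smul, posTrace, posTrace, traceAlong, traceAlong, ← ENNReal.tsum_mul_left]
  refine tsum_congr fun i => ?_
  rw [← ENNReal.ofReal_mul (abs_nonneg r), smul_apply,
    inner_smul_right_eq_smul, Complex.smul_re, Real.norm_eq_abs, smul_eq_mul]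

end PositiveTrace

/-! ## Trace-class operators -/

section TraceClass

variable (h : Type*) [NormedAddCommGroup h] [InnerProductSpace ℂ h] [CompleteSpace h]

variable {h} in
/-- `u` is trace class if `|u| = (u* u)^{1/2}` has finite trace. -/
def IsTraceClass (u : h →L[ℂ] h) : Prop := posTrace (CFC.abs u) < ∞

/-- The real vector space of self-adjoint trace-class operators. -/
def traceClassSASubmodule : Submodule ℝ (h →L[ℂ] h) where
  carrier := {u | IsSelfAdjoint u ∧ IsTraceClass u}
  zero_mem' := ⟨IsSelfAdjoint.zero _, by simp [IsTraceClass, posTrace, traceAlong]⟩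
  add_mem' := by
    rintro u v ⟨hu, hu'⟩ ⟨hv, hv'⟩
    exact ⟨hu.add hv, (posTrace_abs_add_le hu hv).trans_lt (ENNReal.add_lt_top.2 ⟨hu', hv'⟩)⟩
  smul_mem' := by
    rintro r u ⟨hu, hu'⟩
    refine ⟨(IsSelfAdjoint.all r).smul hu, ?_⟩
    unfold IsTraceClass
    rw [posTrace_abs_smul]
    exact ENNReal.mul_lt_top ENNReal.ofReal_lt_top hu'

/-- The space `C₁^sa` of self-adjoint trace-class operators on `h`. It is a type of its own, so
that it carries the trace norm and not the operator norm. -/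
def TraceClassSA : Type _ := traceClassSASubmodule h

instance : AddCommGroup (TraceClassSA h) := inferInstanceAs (AddCommGroup (traceClassSASubmodule h))

instance : Module ℝ (TraceClassSA h) := inferInstanceAs (Module ℝ (traceClassSASubmodule h))

variable {h}

/-- The underlying bounded operator on `h`. -/
def TraceClassSA.toCLM (u : TraceClassSA h) : h →L[ℂ] h := (traceClassSASubmodule h).subtype u

/-- The trace norm `‖u‖ = Tr |u|`. -/
instance : Norm (TraceClassSA h) := ⟨fun u => (posTrace (CFC.abs u.toCLM)).toReal⟩

theorem TraceClassSA.norm_def (u : TraceClassSA h) :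
    ‖u‖ = (posTrace (CFC.abs u.toCLM)).toReal := rfl

theorem TraceClassSA.isSelfAdjoint (u : TraceClassSA h) : IsSelfAdjoint u.toCLM := u.2.1

theorem TraceClassSA.isTraceClass (u : TraceClassSA h) : IsTraceClass u.toCLM := u.2.2

theorem TraceClassSA.core : NormedSpace.Core ℝ (TraceClassSA h) where
  norm_nonneg _ := ENNReal.toReal_nonneg
  norm_smul r u := by
    have : (r • u).toCLM = r • u.toCLM := rfl
    rw [TraceClassSA.norm_def, this, posTrace_abs_smul, ENNReal.toReal_mul,
      ENNReal.toReal_ofReal (abs_nonneg r)]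
    rfl
  norm_triangle u v := by
    have : (u + v).toCLM = u.toCLM + v.toCLM := rfl
    rw [TraceClassSA.norm_def, TraceClassSA.norm_def, TraceClassSA.norm_def, this,
      ← ENNReal.toReal_add u.isTraceClass.ne v.isTraceClass.ne]
    exact ENNReal.toReal_mono (ENNReal.add_ne_top.2 ⟨u.isTraceClass.ne, v.isTraceClass.ne⟩)
      (posTrace_abs_add_le u.isSelfAdjoint v.isSelfAdjoint)
  norm_eq_zero_iff u := by
    constructor
    · intro h0
      have h1 : posTrace (CFC.abs u.toCLM) = 0 :=
        ((ENNReal.toReal_eq_zero_iff _).1 h0).resolve_right u.isTraceClass.ne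
      have h2 : u.toCLM = 0 := CFC.abs_eq_zero_iff.1 (eq_zero_of_posTrace (CFC.abs_nonneg _) h1)
      exact Subtype.ext h2
    · rintro rfl
      have : (0 : TraceClassSA h).toCLM = 0 := rfl
      simp [TraceClassSA.norm_def, this, posTrace, traceAlong]

instance : NormedAddCommGroup (TraceClassSA h) := NormedAddCommGroup.ofCore TraceClassSA.core

instance : NormedSpace ℝ (TraceClassSA h) := NormedSpace.ofCore TraceClassSA.core

/-- The trace `Tr u = ∑ i, (u bᵢ, bᵢ)` of a self-adjoint trace-class operator. The series
converges absolutely and its sum is the same for every orthonormal basis, see `hasSum_trace`. -/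
def trace (u : TraceClassSA h) : ℝ :=
  ∑' i, (inner ℂ (stdBasis h i) (u.toCLM (stdBasis h i))).re

theorem hasSum_traceAlong {ι : Type*} (b : HilbertBasis ι ℂ h) {p : h →L[ℂ] h} (hp : 0 ≤ p)
    (hf : posTrace p < ∞) :
    HasSum (fun i => (inner ℂ (b i) (p (b i))).re) (posTrace p).toReal := by
  rw [posTrace, traceAlong_eq _ b hp] at hf ⊢
  have h1 := ENNReal.hasSum_toReal hf.ne
  have h2 : ∀ i, (ENNReal.ofReal (inner ℂ (b i) (p (b i))).re).toReal
      = (inner ℂ (b i) (p (b i))).re := fun i => ENNReal.toReal_ofReal (inner_re_nonneg hp _)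
  simp_rw [h2] at h1
  rw [traceAlong, ENNReal.tsum_toReal_eq (fun i => ENNReal.ofReal_ne_top)]
  simp_rw [h2]
  exact h1

theorem hasSum_trace {ι : Type*} (b : HilbertBasis ι ℂ h) (u : TraceClassSA h) :
    HasSum (fun i => (inner ℂ (b i) (u.toCLM (b i))).re) (trace u) := by
  set a := u.toCLM with ha
  have h1 : CFC.abs a = a⁺ + a⁻ := (CFC.posPart_add_negPart a u.isSelfAdjoint).symm
  have h2 : a⁺ - a⁻ = a := CFC.posPart_sub_negPart a u.isSelfAdjoint
  have h3 : posTrace a⁺ + posTrace a⁻ < ∞ := by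
    rw [posTrace, posTrace, ← traceAlong_add _ (CFC.posPart_nonneg a) (CFC.negPart_nonneg a), ← h1]
    exact u.isTraceClass
  rw [ENNReal.add_lt_top] at h3
  have key : ∀ x, (inner ℂ x (a x)).re = (inner ℂ x (a⁺ x)).re - (inner ℂ x (a⁻ x)).re := by
    intro x
    conv_lhs => rw [← h2]
    simp [inner_sub_right]
  have h5 : trace u = (posTrace a⁺).toReal - (posTrace a⁻).toReal := by
    rw [trace, ← ((hasSum_traceAlong (stdBasis h) (CFC.posPart_nonneg a) h3.1).sub
      (hasSum_traceAlong (stdBasis h) (CFC.negPart_nonneg a) h3.2)).tsum_eq]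
    exact tsum_congr fun i => key _
  rw [h5]
  simp_rw [key]
  exact (hasSum_traceAlong b (CFC.posPart_nonneg a) h3.1).sub
    (hasSum_traceAlong b (CFC.negPart_nonneg a) h3.2)

/-- `u ≥ 0`: the operator `u` is positive, that is, `(u x, x) ≥ 0` for all `x`. -/
def IsPos (u : TraceClassSA h) : Prop := u.toCLM.IsPositive

end TraceClass

/-! ## Semigroups and generators on a real normed space -/

section Semigroups

variable {X : Type*} [NormedAddCommGroup X] [NormedSpace ℝ X]

/-- `(T_t)_{t > 0}` is a `C₀`-semigroup; values at `t ≤ 0` play no role. -/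
structure IsC0Semigroup (T : ℝ → X →L[ℝ] X) : Prop where
  add : ∀ s t, 0 < s → 0 < t → T (s + t) = T s ∘L T t
  tendsto_zero : ∀ u, Tendsto (fun t => T t u) (𝓝[>] 0) (𝓝 u)

/-- `A` is the generator of `(T_t)_{t > 0}`: `u ∈ D(A)` with `A u = v` if and only if
`(T_t u - u) / t → v` as `t ↓ 0`. -/
def IsGenerator (T : ℝ → X →L[ℝ] X) (A : X →ₗ.[ℝ] X) : Prop :=
  ∀ u v, (u, v) ∈ A.graph ↔ Tendsto (fun t : ℝ => t⁻¹ • (T t u - u)) (𝓝[>] 0) (𝓝 v)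

/-- The operator `A - K` with domain `D(A)`, where `K : D(A) → X`. -/
def subPert (A : X →ₗ.[ℝ] X) (K : A.domain →ₗ[ℝ] X) : X →ₗ.[ℝ] X :=
  ⟨A.domain, A.toFun - K⟩

/-- `R = (λ I + A)⁻¹`, as a bounded operator defined on all of `X`. -/
def IsResolvent (A : X →ₗ.[ℝ] X) (lam : ℝ) (R : X →L[ℝ] X) : Prop :=
  (∀ u : X, ∃ w : A.domain, (w : X) = R u ∧ lam • (w : X) + A w = u) ∧
    ∀ w : A.domain, R (lam • (w : X) + A w) = w

/-- `A` is `m`-accretive: for all `λ > 0` the operator `λ I + A` maps `D(A)` onto `X` and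
`‖(λ I + A) u‖ ≥ λ ‖u‖` for all `u ∈ D(A)`. -/
def IsMAccretive (A : X →ₗ.[ℝ] X) : Prop :=
  ∀ lam : ℝ, 0 < lam →
    (∀ w : A.domain, lam * ‖(w : X)‖ ≤ ‖lam • (w : X) + A w‖) ∧
    ∀ u : X, ∃ w : A.domain, lam • (w : X) + A w = u

end Semigroups

/-! ## Positivity on the space of self-adjoint trace-class operators -/

section Positivity

variable {h : Type*} [NormedAddCommGroup h] [InnerProductSpace ℂ h] [CompleteSpace h]

/-- `A ≥ 0` for a linear map `A : D → C₁^sa`: `A u ≥ 0` for all `u ∈ D` with `u ≥ 0`. -/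
def PosPreserving {D : Submodule ℝ (TraceClassSA h)} (A : D →ₗ[ℝ] TraceClassSA h) : Prop :=
  ∀ u : D, IsPos (u : TraceClassSA h) → IsPos (A u)

/-- `A ≥ 0` for a bounded operator on `C₁^sa`. -/
def PosPreservingCLM (A : TraceClassSA h →L[ℝ] TraceClassSA h) : Prop :=
  ∀ u : TraceClassSA h, IsPos u → IsPos (A u)

/-- `(T_t)_{t > 0}` is a positivity preserving contraction `C₀`-semigroup. -/
structure IsDynamicalSemigroup (T : ℝ → TraceClassSA h →L[ℝ] TraceClassSA h) : Prop where
  c0 : IsC0Semigroup T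
  contraction : ∀ t, 0 < t → ‖T t‖ ≤ 1
  pos : ∀ t, 0 < t → PosPreservingCLM (T t)

/-- `(K_α)` is a functional regularisation of `K : D(H) → C₁^sa`. -/
structure IsFunctionalRegularisation {J : Type*} [Preorder J]
    (H : TraceClassSA h →ₗ.[ℝ] TraceClassSA h) (K : H.domain →ₗ[ℝ] TraceClassSA h)
    (Kα : J → H.domain →ₗ[ℝ] TraceClassSA h) : Prop where
  pos : ∀ α, PosPreserving (Kα α)
  bound : ∀ α, ∃ a b : ℝ, 0 ≤ a ∧ 0 ≤ b ∧ b < 1 ∧ ∀ u : H.domain, IsPos (u : TraceClassSA h) →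
    trace (Kα α u) ≤ a * trace (u : TraceClassSA h) + b * trace (H u)
  mono : ∀ α β, α ≤ β → PosPreserving (Kα β - Kα α) ∧ PosPreserving (K - Kα β)
  tendsto : ∀ u : H.domain, IsPos (u : TraceClassSA h) → ∃ V : Submodule ℂ h, Dense (V : Set h) ∧
    ∀ x ∈ V, Tendsto (fun α => inner ℂ ((Kα α u).toCLM x) x) atTop
      (𝓝 (inner ℂ ((K u).toCLM x) x))

end Positivity

end KatoReg

end

/-! The trace norm is additive on the positive cone: `‖u‖ = Tr u` for `u ≥ 0`, and every `u` is `p -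
q` with `p, q ≥ 0` and `‖p‖ + ‖q‖ ≤ ‖u‖` (`isAdditiveNorm_traceCLM`). With completeness and
closedness of the cone, this is all that the abstract theorem `exists_semigroup_of_regularisation`
needs. Norm bounds and strong limits may be tested on the cone, and an increasing net with bounded
trace converges in norm, because the norm of an increment is the increment of the trace
(`exists_tendsto_of_monotone`).

Put `R₀ = (λ + H)⁻¹`, so that `λ + L_α = (I - K_α R₀)(λ + H)`. The bounds `Tr K_α ≤ Tr H` and (II)
together give `‖K_α R₀‖ < 1` for every `λ > 0`. The Neumann series is then a positive inverse, and
`Tr (L_α w) ≥ 0` for `w ≥ 0` bounds it by `1/λ` (`exists_resolvent_subPert`). Hille–Yosida yields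
`T^α`. The resolvents are positive and increase with `α`; the Yosida approximation hands both
properties to the semigroups.

Hence `T^α_t u` increases for `u ≥ 0`, with trace at most `Tr u`, and converges. Strong continuity
of the limit rests on `‖r - u‖ ≤ 2 ‖p - u‖` for `p ≤ r` and `Tr r ≤ Tr u` (`norm_sub_le_two_mul`):
one `T^α` controls the limit and all later `T^β` near `t = 0`. The same uniformity identifies the
limit of the resolvents with `(λ + L)⁻¹` (`tendsto_resolvent_of_monotone`).

Finally `K_α u → K u` in trace norm, since this net is increasing and bounded by `K u` for `u ≥ 0`
and its limit has the quadratic form of `K u`. Passing to the limit in `w = (I + L_α)⁻¹ (I + L_α) w`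
shows that `L` extends `H - K`. -/

noncomputable section

namespace KatoReg

/-! ### Contraction semigroups, generators and resolvents -/

section ContractionSemigroups

variable {X : Type*} [NormedAddCommGroup X] [NormedSpace ℝ X]

/-- A contraction `C₀`-semigroup. -/
structure IsContractionSemigroup (T : ℝ → X →L[ℝ] X) : Prop where
  c0 : IsC0Semigroup T
  contraction : ∀ t, 0 < t → ‖T t‖ ≤ 1

/-- `u` is in the domain of the generator of `T`, which maps it to `v`. -/
def HasGen (T : ℝ → X →L[ℝ] X) (u v : X) : Prop :=
  Tendsto (fun t : ℝ => t⁻¹ • (T t u - u)) (𝓝[>] 0) (𝓝 v)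

/-- The semigroup `T`, extended by the identity to `t ≤ 0`. -/
def extendId (T : ℝ → X →L[ℝ] X) (t : ℝ) : X →L[ℝ] X :=
  if 0 < t then T t else ContinuousLinearMap.id ℝ X

theorem extendId_of_pos (T : ℝ → X →L[ℝ] X) {t : ℝ} (ht : 0 < t) : extendId T t = T t :=
  if_pos ht

theorem extendId_of_nonpos (T : ℝ → X →L[ℝ] X) {t : ℝ} (ht : t ≤ 0) :
    extendId T t = ContinuousLinearMap.id ℝ X :=
  if_neg ht.not_gt

namespace IsContractionSemigroup

variable {T : ℝ → X →L[ℝ] X} (hT : IsContractionSemigroup T)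
include hT

theorem norm_apply_le {t : ℝ} (ht : 0 < t) (u : X) : ‖T t u‖ ≤ ‖u‖ := by
  simpa using (T t).le_of_opNorm_le (hT.contraction t ht) u

theorem norm_extendId_apply_le (t : ℝ) (u : X) : ‖extendId T t u‖ ≤ ‖u‖ := by
  rcases lt_or_ge 0 t with ht | ht
  · rw [extendId_of_pos T ht]
    exact hT.norm_apply_le ht u
  · simp [extendId_of_nonpos T ht]

theorem extendId_add {s t : ℝ} (hs : 0 ≤ s) (ht : 0 ≤ t) (u : X) :
    extendId T (s + t) u = extendId T s (extendId T t u) := by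
  rcases hs.eq_or_lt with rfl | hs
  · simp [extendId_of_nonpos T le_rfl]
  rcases ht.eq_or_lt with rfl | ht
  · simp [extendId_of_nonpos T le_rfl]
  rw [extendId_of_pos T hs, extendId_of_pos T ht, extendId_of_pos T (add_pos hs ht),
    hT.c0.add s t hs ht]
  rfl

theorem tendsto_extendId_zero (u : X) : Tendsto (fun t => extendId T t u) (𝓝 0) (𝓝 u) := by
  rw [← nhdsLE_sup_nhdsGT, tendsto_sup]
  constructor
  · refine tendsto_const_nhds.congr' ?_
    filter_upwards [self_mem_nhdsWithin] with t ht
    simp [extendId_of_nonpos T ht]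
  · refine (hT.c0.tendsto_zero u).congr' ?_
    filter_upwards [self_mem_nhdsWithin] with t ht
    rw [extendId_of_pos T ht]

theorem norm_extendId_sub_le {s t : ℝ} (hs : 0 ≤ s) (hst : s ≤ t) (u : X) :
    ‖extendId T t u - extendId T s u‖ ≤ ‖extendId T (t - s) u - u‖ := by
  have h1 : extendId T t u = extendId T s (extendId T (t - s) u) := by
    rw [← hT.extendId_add hs (sub_nonneg.2 hst)]
    congr 2
    ring
  rw [h1, ← map_sub]
  exact hT.norm_extendId_apply_le _ _

/-- Contractivity bounds the displacement between two times by the displacement from time `0` over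
their distance, so right continuity at `0` gives continuity everywhere. Negative times are folded
into `0` by `max t 0`. -/
theorem continuous_extendId (u : X) : Continuous fun t => extendId T t u := by
  have hmax : ∀ t, extendId T t u = extendId T (max t 0) u := by
    intro t
    rcases le_total t 0 with ht | ht
    · rw [max_eq_right ht, extendId_of_nonpos T ht, extendId_of_nonpos T le_rfl]
    · rw [max_eq_left ht]
  have key : ∀ s t, ‖extendId T t u - extendId T s u‖
      ≤ ‖extendId T |max t 0 - max s 0| u - u‖ := by
    intro s t
    rw [hmax t, hmax s]
    rcases le_total (max s 0) (max t 0) with hst | hst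
    · rw [abs_of_nonneg (sub_nonneg.2 hst)]
      exact hT.norm_extendId_sub_le (le_max_right _ _) hst u
    · rw [abs_of_nonpos (sub_nonpos.2 hst), neg_sub, norm_sub_rev]
      exact hT.norm_extendId_sub_le (le_max_right _ _) hst u
  rw [continuous_iff_continuousAt]
  intro s
  refine tendsto_iff_norm_sub_tendsto_zero.2 (squeeze_zero (fun _ => norm_nonneg _) (key s) ?_)
  have h1 : Tendsto (fun t : ℝ => |max t 0 - max s 0|) (𝓝 s) (𝓝 0) := by
    have : Continuous fun t : ℝ => |max t 0 - max s 0| := by fun_prop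
    simpa using this.tendsto s
  simpa using (((hT.tendsto_extendId_zero u).comp h1).sub_const u).norm

/-- Dissipativity: replacing `v` by its difference quotient leaves `(λ + 1/t) u - (1/t) T_t u`,
where the second term has norm at most `‖u‖ / t`. -/
theorem mul_norm_le_of_hasGen {u v : X} (h : HasGen T u v) {lam : ℝ} (hl : 0 < lam) :
    lam * ‖u‖ ≤ ‖lam • u - v‖ := by
  refine ge_of_tendsto (h.const_sub (lam • u)).norm ?_
  filter_upwards [self_mem_nhdsWithin] with t (ht : 0 < t)
  have h1 : lam • u - t⁻¹ • (T t u - u) = (lam + t⁻¹) • u - t⁻¹ • T t u := by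
    rw [smul_sub, add_smul]
    abel
  have h2 : ‖(lam + t⁻¹) • u‖ = lam * ‖u‖ + t⁻¹ * ‖u‖ := by
    rw [norm_smul, Real.norm_of_nonneg (by positivity), add_mul]
  have h3 : ‖t⁻¹ • T t u‖ ≤ t⁻¹ * ‖u‖ := by
    rw [norm_smul, Real.norm_of_nonneg (by positivity)]
    gcongr
    exact hT.norm_apply_le ht u
  rw [h1]
  linarith [norm_sub_norm_le ((lam + t⁻¹) • u) (t⁻¹ • T t u)]

end IsContractionSemigroup

theorem HasGen.unique {T : ℝ → X →L[ℝ] X} {u v w : X} (h : HasGen T u v) (h' : HasGen T u w) :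
    v = w :=
  tendsto_nhds_unique h h'

theorem HasGen.add {T : ℝ → X →L[ℝ] X} {u v u' v' : X} (h : HasGen T u v) (h' : HasGen T u' v') :
    HasGen T (u + u') (v + v') := by
  refine (Tendsto.add h h').congr fun t => ?_
  rw [← smul_add, map_add]
  congr 1
  abel

theorem HasGen.smul {T : ℝ → X →L[ℝ] X} {u v : X} (h : HasGen T u v) (c : ℝ) :
    HasGen T (c • u) (c • v) := by
  refine (Tendsto.const_smul h c).congr fun t => ?_
  rw [smul_comm, map_smul, smul_sub c]

theorem HasGen.sub {T : ℝ → X →L[ℝ] X} {u v u' v' : X} (h : HasGen T u v) (h' : HasGen T u' v') :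
    HasGen T (u - u') (v - v') := by
  simpa [sub_eq_add_neg] using h.add (h'.smul (-1))

theorem hasGen_zero (T : ℝ → X →L[ℝ] X) : HasGen T 0 0 := by
  simp [HasGen, tendsto_const_nhds]

/-- Every family of operators has a generator, possibly with a small domain. -/
theorem exists_isGenerator (T : ℝ → X →L[ℝ] X) : ∃ A : X →ₗ.[ℝ] X, IsGenerator T A := by
  let D : Submodule ℝ X :=
    { carrier := {u | ∃ v, HasGen T u v}
      zero_mem' := ⟨0, hasGen_zero T⟩
      add_mem' := fun ⟨v, hv⟩ ⟨w, hw⟩ => ⟨v + w, hv.add hw⟩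
      smul_mem' := fun c _ ⟨v, hv⟩ => ⟨c • v, hv.smul c⟩ }
  have hD : ∀ u : D, HasGen T (u : X) u.2.choose := fun u => u.2.choose_spec
  let A : X →ₗ.[ℝ] X := ⟨D,
    { toFun := fun u => u.2.choose
      map_add' := fun u v => (hD (u + v)).unique ((hD u).add (hD v))
      map_smul' := fun c u => (hD (c • u)).unique ((hD u).smul c) }⟩
  refine ⟨A, fun u v => ?_⟩
  rw [LinearPMap.mem_graph_iff]
  constructor
  · rintro ⟨y, rfl, rfl⟩
    exact hD y
  · intro h
    exact ⟨⟨u, v, h⟩, rfl, (hD ⟨u, v, h⟩).unique h⟩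

section Generator

variable {T : ℝ → X →L[ℝ] X} {A : X →ₗ.[ℝ] X}

theorem IsGenerator.hasGen (h : IsGenerator T (-A)) (w : A.domain) :
    HasGen T (w : X) (-(A w)) :=
  (h _ _).1 ((LinearPMap.mem_graph_iff _).2 ⟨w, rfl, rfl⟩)

theorem IsGenerator.exists_of_hasGen (h : IsGenerator T (-A)) {u v : X} (huv : HasGen T u v) :
    ∃ w : A.domain, (w : X) = u ∧ -(A w) = v := by
  obtain ⟨w, hw, hw'⟩ := (LinearPMap.mem_graph_iff _).1 ((h u v).2 huv)
  exact ⟨w, hw, hw'⟩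

theorem isGenerator_neg_of (h1 : ∀ w : A.domain, HasGen T (w : X) (-(A w)))
    (h2 : ∀ u v, HasGen T u v → ∃ w : A.domain, (w : X) = u ∧ -(A w) = v) :
    IsGenerator T (-A) := by
  intro u v
  rw [LinearPMap.mem_graph_iff]
  constructor
  · rintro ⟨w, rfl, rfl⟩
    exact h1 w
  · intro h
    obtain ⟨w, hw, hw'⟩ := h2 u v h
    exact ⟨w, hw, hw'⟩

/-- If `-A` is contained in the generator of a contraction semigroup and `I + A` is onto, then
`-A` is the generator. -/
theorem IsContractionSemigroup.isGenerator_of_surjective (hT : IsContractionSemigroup T)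
    (h1 : ∀ w : A.domain, HasGen T (w : X) (-(A w)))
    (h2 : ∀ u : X, ∃ w : A.domain, (w : X) + A w = u) : IsGenerator T (-A) := by
  refine isGenerator_neg_of h1 fun u v huv => ?_
  obtain ⟨w, hw⟩ := h2 (u - v)
  -- Both `u` and `w` solve the same equation for `I` minus the generator, and dissipativity makes
  -- that operator injective.
  have h3 := hT.mul_norm_le_of_hasGen (huv.sub (h1 w)) one_pos
  have h4 : (1 : ℝ) • (u - (w : X)) - (v - -(A w)) = 0 := by
    rw [one_smul]
    have : u - (w : X) - (v - -(A w)) = (u - v) - ((w : X) + A w) := by abel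
    rw [this, hw, sub_self]
  rw [h4, norm_zero, one_mul] at h3
  have h5 : (w : X) = u := (sub_eq_zero.1 (norm_le_zero_iff.1 h3)).symm
  refine ⟨w, h5, ?_⟩
  have h6 := h1 w
  rw [h5] at h6
  exact h6.unique huv

theorem IsContractionSemigroup.mul_norm_le (hT : IsContractionSemigroup T)
    (hA : IsGenerator T (-A)) {lam : ℝ} (hl : 0 < lam) (w : A.domain) :
    lam * ‖(w : X)‖ ≤ ‖lam • (w : X) + A w‖ := by
  simpa using hT.mul_norm_le_of_hasGen (hA.hasGen w) hl

/-- It is enough to differentiate the rescaled semigroup `exp (-λ t) T_t`. -/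
theorem hasGen_of_tendsto_exp {w u : X} {lam : ℝ}
    (h : Tendsto (fun t : ℝ => t⁻¹ • (Real.exp (-(lam * t)) • T t w - w)) (𝓝[>] 0) (𝓝 (-u))) :
    HasGen T w (lam • w - u) := by
  have h1 : Tendsto (fun t : ℝ => Real.exp (lam * t)) (𝓝[>] 0) (𝓝 1) := by
    have : Continuous fun t : ℝ => Real.exp (lam * t) := by fun_prop
    simpa using (this.tendsto 0).mono_left nhdsWithin_le_nhds
  have h2 : Tendsto (fun t : ℝ => t⁻¹ * (Real.exp (lam * t) - 1)) (𝓝[>] 0) (𝓝 lam) := by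
    have h3 : HasDerivAt (fun t : ℝ => Real.exp (lam * t)) lam 0 := by
      simpa using ((hasDerivAt_id (0 : ℝ)).const_mul lam).exp
    simpa using h3.tendsto_slope_zero_right
  -- Product rule: `T_t w - w = e^{λt} (e^{-λt} T_t w - w) + (e^{λt} - 1) w`.
  have h3 := (h1.smul h).add (h2.smul_const w)
  rw [one_smul, neg_add_eq_sub] at h3
  refine h3.congr fun t => ?_
  have h4 : Real.exp (lam * t) * Real.exp (-(lam * t)) = 1 := by
    rw [← Real.exp_add, add_neg_cancel, Real.exp_zero]
  rw [smul_comm, smul_sub (Real.exp (lam * t)), smul_smul (Real.exp (lam * t)), h4, one_smul,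
    mul_smul, ← smul_add, sub_smul, one_smul]
  congr 1
  abel

end Generator

/-! ### Resolvents -/

theorem IsResolvent.unique {A : X →ₗ.[ℝ] X} {lam : ℝ} {R R' : X →L[ℝ] X} (h : IsResolvent A lam R)
    (h' : IsResolvent A lam R') : R = R' := by
  ext u
  obtain ⟨w, hw, hw'⟩ := h'.1 u
  rw [← hw, ← hw', h.2 w]

theorem IsMAccretive.exists_isResolvent {A : X →ₗ.[ℝ] X} (hA : IsMAccretive A) {lam : ℝ}
    (hl : 0 < lam) : ∃ R : X →L[ℝ] X, IsResolvent A lam R ∧ ∀ u, lam * ‖R u‖ ≤ ‖u‖ := by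
  obtain ⟨h1, h2⟩ := hA lam hl
  let F : A.domain →ₗ[ℝ] X := lam • A.domain.subtype + A.toFun
  have hF : ∀ w, F w = lam • (w : X) + A w := fun w => rfl
  have hinj : Function.Injective F := by
    rw [← LinearMap.ker_eq_bot, LinearMap.ker_eq_bot']
    intro w hw
    have h3 := h1 w
    rw [← hF, hw, norm_zero] at h3
    have h4 : ‖(w : X)‖ = 0 := le_antisymm (by nlinarith [norm_nonneg (w : X)]) (norm_nonneg _)
    exact Subtype.ext (norm_eq_zero.1 h4)
  let e := LinearEquiv.ofBijective F ⟨hinj, h2⟩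
  have he : ∀ u, lam • ((e.symm u : A.domain) : X) + A (e.symm u) = u :=
    fun u => e.apply_symm_apply u
  have hb : ∀ u, lam * ‖((e.symm u : A.domain) : X)‖ ≤ ‖u‖ := by
    intro u
    have := h1 (e.symm u)
    rwa [he] at this
  let R : X →L[ℝ] X := (A.domain.subtype ∘ₗ e.symm.toLinearMap).mkContinuous lam⁻¹ fun u => by
    rw [inv_mul_eq_div, le_div_iff₀ hl, mul_comm]
    exact hb u
  refine ⟨R, ⟨fun u => ⟨e.symm u, rfl, he u⟩, fun w => ?_⟩, hb⟩
  exact congrArg Subtype.val (e.symm_apply_apply w)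

theorem IsMAccretive.of_isResolvent {A : X →ₗ.[ℝ] X} (h : ∀ lam : ℝ, 0 < lam →
    ∃ R : X →L[ℝ] X, IsResolvent A lam R ∧ ∀ u, lam * ‖R u‖ ≤ ‖u‖) : IsMAccretive A := by
  intro lam hl
  obtain ⟨R, hR, hb⟩ := h lam hl
  refine ⟨fun w => ?_, fun u => ?_⟩
  · have := hb (lam • (w : X) + A w)
    rwa [hR.2] at this
  · obtain ⟨w, -, hw⟩ := hR.1 u
    exact ⟨w, hw⟩

/-! ### The resolvent as a Laplace transform -/

section Laplace

open MeasureTheory Set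

variable {T : ℝ → X →L[ℝ] X}

/-- The orbit of `u` under the rescaled semigroup `exp (-λ t) T_t`. -/
def expOrbit (T : ℝ → X →L[ℝ] X) (lam : ℝ) (u : X) (t : ℝ) : X :=
  Real.exp (-(lam * t)) • extendId T t u

theorem expOrbit_zero (T : ℝ → X →L[ℝ] X) (lam : ℝ) (u : X) : expOrbit T lam u 0 = u := by
  simp [expOrbit, extendId_of_nonpos T le_rfl]

/-- The Laplace transform of the orbit of `u`. -/
def laplace (T : ℝ → X →L[ℝ] X) (lam : ℝ) (u : X) : X :=
  ∫ t in Ioi (0 : ℝ), expOrbit T lam u t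

namespace IsContractionSemigroup

variable (hT : IsContractionSemigroup T)
include hT

theorem continuous_expOrbit (lam : ℝ) (u : X) : Continuous (expOrbit T lam u) := by
  have := hT.continuous_extendId u
  unfold expOrbit
  fun_prop

theorem integrableOn_expOrbit {lam : ℝ} (hl : 0 < lam) (u : X) :
    IntegrableOn (expOrbit T lam u) (Ioi 0) := by
  have h1 : IntegrableOn (fun t : ℝ => Real.exp (-lam * t) * ‖u‖) (Ioi 0) :=
    (exp_neg_integrableOn_Ioi 0 hl).mul_const _
  refine h1.mono' (hT.continuous_expOrbit lam u).aestronglyMeasurable ?_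
  filter_upwards with t
  rw [expOrbit, norm_smul, Real.norm_of_nonneg (Real.exp_pos _).le, neg_mul]
  gcongr
  exact hT.norm_extendId_apply_le t u

theorem tendsto_average_expOrbit [CompleteSpace X] (lam : ℝ) (u : X) :
    Tendsto (fun t : ℝ => t⁻¹ • ∫ s in (0 : ℝ)..t, expOrbit T lam u s) (𝓝[>] 0) (𝓝 u) := by
  have h1 : HasDerivAt (fun t : ℝ => ∫ s in (0 : ℝ)..t, expOrbit T lam u s) u 0 := by
    have := (hT.continuous_expOrbit lam u).integral_hasStrictDerivAt 0 0
    rw [expOrbit_zero] at this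
    exact this.hasDerivAt
  simpa using h1.tendsto_slope_zero_right

/-- The rescaled semigroup translates the orbit, so it turns the integral over `(0, ∞)` into the one
over `(t, ∞)`. Dividing the missing piece by `t` then puts the Laplace transform in the domain of
the generator. -/
theorem exp_smul_laplace [CompleteSpace X] {lam : ℝ} (hl : 0 < lam) {t : ℝ} (ht : 0 < t) (u : X) :
    Real.exp (-(lam * t)) • T t (laplace T lam u)
      = laplace T lam u - ∫ s in (0 : ℝ)..t, expOrbit T lam u s := by
  have h1 : Real.exp (-(lam * t)) • T t (laplace T lam u)
      = ∫ s in Ioi (0 : ℝ), expOrbit T lam u (s + t) := by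
    rw [laplace, ← ContinuousLinearMap.integral_comp_comm _ (hT.integrableOn_expOrbit hl u),
      ← integral_smul]
    refine setIntegral_congr_fun measurableSet_Ioi fun s (hs : 0 < s) => ?_
    simp only [expOrbit]
    rw [map_smul, smul_smul, ← Real.exp_add, add_comm s t, hT.extendId_add ht.le hs.le,
      extendId_of_pos T ht]
    congr 2
    ring
  have h2 : ∫ s in Ioi (0 : ℝ), expOrbit T lam u (s + t) = ∫ s in Ioi t, expOrbit T lam u s := by
    have h3 := (measurePreserving_add_right volume t).setIntegral_preimage_emb
      (measurableEmbedding_addRight t) (expOrbit T lam u) (Ioi t)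
    rw [← h3]
    congr 2
    ext s
    simp
  have h3 := intervalIntegral.integral_interval_add_Ioi (a := 0) (b := t)
    (hT.integrableOn_expOrbit hl u)
    ((hT.integrableOn_expOrbit hl u).mono_set (Ioi_subset_Ioi ht.le))
  rw [h1, h2, laplace, ← h3]
  abel

theorem hasGen_laplace [CompleteSpace X] {lam : ℝ} (hl : 0 < lam) (u : X) :
    HasGen T (laplace T lam u) (lam • laplace T lam u - u) := by
  refine hasGen_of_tendsto_exp ?_
  refine (hT.tendsto_average_expOrbit lam u).neg.congr' ?_
  filter_upwards [self_mem_nhdsWithin] with t (ht : 0 < t)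
  rw [hT.exp_smul_laplace hl ht, sub_sub_cancel_left, smul_neg]

theorem isMAccretive [CompleteSpace X] {A : X →ₗ.[ℝ] X} (hA : IsGenerator T (-A)) :
    IsMAccretive A := by
  refine fun lam hl => ⟨hT.mul_norm_le hA hl, fun u => ?_⟩
  obtain ⟨w, hw, hw'⟩ := hA.exists_of_hasGen (hT.hasGen_laplace hl u)
  refine ⟨w, ?_⟩
  rw [hw, neg_eq_iff_eq_neg.1 hw']
  abel

theorem resolvent_apply_eq_laplace [CompleteSpace X] {A : X →ₗ.[ℝ] X} (hA : IsGenerator T (-A))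
    {lam : ℝ} (hl : 0 < lam) {R : X →L[ℝ] X} (hR : IsResolvent A lam R) (u : X) :
    R u = laplace T lam u := by
  obtain ⟨w, hw, hw'⟩ := hA.exists_of_hasGen (hT.hasGen_laplace hl u)
  have h1 : lam • (w : X) + A w = u := by
    rw [hw, neg_eq_iff_eq_neg.1 hw']
    abel
  rw [← hw, ← h1, hR.2]

/-- The domain is invariant under `T_t`, so the difference quotients of `w ∈ D(A)` stay in it and
their limit `-A w` lies in its closure. Every `u` has the form `w + A w`. -/
theorem dense_domain [CompleteSpace X] {A : X →ₗ.[ℝ] X} (hA : IsGenerator T (-A)) :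
    Dense (A.domain : Set X) := by
  intro u
  obtain ⟨w, hw⟩ := (hT.isMAccretive hA 1 one_pos).2 u
  have hgen := hA.hasGen w
  have hinv : ∀ t : ℝ, 0 < t → T t (w : X) ∈ A.domain := by
    intro t ht
    have h1 : HasGen T (T t (w : X)) (T t (-(A w))) := by
      refine (((T t).continuous.tendsto _).comp hgen).congr' ?_
      filter_upwards [self_mem_nhdsWithin] with s (hs : 0 < s)
      have h2 : T t (T s (w : X)) = T s (T t (w : X)) := by
        have h3 := hT.c0.add t s ht hs
        rw [add_comm, hT.c0.add s t hs ht] at h3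
        exact (DFunLike.congr_fun h3 (w : X)).symm
      simp [h2]
    obtain ⟨w', hw', -⟩ := hA.exists_of_hasGen h1
    rw [← hw']
    exact w'.2
  have hcl : -(A w) ∈ closure (A.domain : Set X) := by
    refine mem_closure_of_tendsto hgen ?_
    filter_upwards [self_mem_nhdsWithin] with t ht
    exact A.domain.smul_mem _ (A.domain.sub_mem (hinv t ht) w.2)
  rw [← hw, one_smul]
  have h3 : (w : X) - -(A w) ∈ A.domain.topologicalClosure :=
    sub_mem (subset_closure w.2) hcl
  rw [sub_neg_eq_add] at h3
  exact h3

end IsContractionSemigroup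

end Laplace

end ContractionSemigroups

/-! ### The Hille–Yosida theorem -/

section HilleYosida

variable {X : Type*} [NormedAddCommGroup X] [NormedSpace ℝ X]

/-! ### Strong limits of contractions -/

section StrongLimits

variable {ι : Type*} {l : Filter ι} {F : ι → X →L[ℝ] X}

theorem tendsto_apply_of_contraction (hF : ∀ᶠ i in l, ∀ u, ‖F i u‖ ≤ ‖u‖) {v : ι → X} {v₀ w : X}
    (hv : Tendsto v l (𝓝 v₀)) (hw : Tendsto (fun i => F i v₀) l (𝓝 w)) :
    Tendsto (fun i => F i (v i)) l (𝓝 w) := by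
  have h1 : Tendsto (fun i => F i (v i - v₀)) l (𝓝 0) := by
    refine squeeze_zero_norm' ?_ (tendsto_iff_norm_sub_tendsto_zero.1 hv)
    filter_upwards [hF] with i hi using hi _
  have h2 := h1.add hw
  rw [zero_add] at h2
  refine h2.congr fun i => ?_
  rw [map_sub, sub_add_cancel]

theorem tendsto_of_dense (hF : ∀ᶠ i in l, ∀ u, ‖F i u‖ ≤ ‖u‖) {G : X →L[ℝ] X}
    (hG : ∀ u, ‖G u‖ ≤ ‖u‖) {D : Set X} (hD : Dense D)
    (h : ∀ d ∈ D, Tendsto (fun i => F i d) l (𝓝 (G d))) (u : X) :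
    Tendsto (fun i => F i u) l (𝓝 (G u)) := by
  rw [Metric.tendsto_nhds]
  intro ε hε
  obtain ⟨d, hd, hud⟩ := hD.exists_dist_lt u (by positivity : 0 < ε / 3)
  filter_upwards [hF, Metric.tendsto_nhds.1 (h d hd) (ε / 3) (by positivity)] with i hi hi'
  have h1 : dist (F i u) (F i d) ≤ dist u d := by
    rw [dist_eq_norm, dist_eq_norm, ← map_sub]
    exact hi _
  have h2 : dist (G d) (G u) ≤ dist u d := by
    rw [dist_comm, dist_eq_norm, dist_eq_norm, ← map_sub]
    exact hG _
  linarith [dist_triangle4 (F i u) (F i d) (G d) (G u)]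

theorem exists_tendsto_of_dense [CompleteSpace X] [l.NeBot] (hF : ∀ᶠ i in l, ∀ u, ‖F i u‖ ≤ ‖u‖)
    {D : Set X} (hD : Dense D) (h : ∀ d ∈ D, ∃ v, Tendsto (fun i => F i d) l (𝓝 v)) (u : X) :
    ∃ v, Tendsto (fun i => F i u) l (𝓝 v) := by
  rw [← cauchy_map_iff_exists_tendsto, Metric.cauchy_iff]
  refine ⟨inferInstance, fun ε hε => ?_⟩
  obtain ⟨d, hd, hud⟩ := hD.exists_dist_lt u (by positivity : 0 < ε / 4)
  obtain ⟨v, hv⟩ := h d hd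
  refine ⟨_, image_mem_map (inter_mem hF (Metric.tendsto_nhds.1 hv (ε / 4) (by positivity))), ?_⟩
  have key : ∀ i, (∀ u, ‖F i u‖ ≤ ‖u‖) → dist (F i d) v < ε / 4 → dist (F i u) v < ε / 2 := by
    intro i hi hi'
    have h1 : dist (F i u) (F i d) ≤ dist u d := by
      rw [dist_eq_norm, dist_eq_norm, ← map_sub]
      exact hi _
    linarith [dist_triangle (F i u) (F i d) v]
  rintro _ ⟨i, hi, rfl⟩ _ ⟨j, hj, rfl⟩
  linarith [key i hi.1 hi.2, key j hj.1 hj.2, dist_triangle_right (F i u) (F j u) v]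

theorem exists_clm_of_tendsto [l.NeBot] (hF : ∀ᶠ i in l, ∀ u, ‖F i u‖ ≤ ‖u‖)
    (h : ∀ u, ∃ v, Tendsto (fun i => F i u) l (𝓝 v)) :
    ∃ T : X →L[ℝ] X, (∀ u, ‖T u‖ ≤ ‖u‖) ∧ ∀ u, Tendsto (fun i => F i u) l (𝓝 (T u)) := by
  choose g hg using h
  let T₀ : X →ₗ[ℝ] X :=
    { toFun := g
      map_add' := fun u v => tendsto_nhds_unique (hg (u + v)) (by
        simpa only [map_add] using (hg u).add (hg v))
      map_smul' := fun c u => tendsto_nhds_unique (hg (c • u)) (by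
        simpa only [map_smul, RingHom.id_apply] using (hg u).const_smul c) }
  have hb : ∀ u, ‖g u‖ ≤ ‖u‖ := by
    intro u
    refine le_of_tendsto (hg u).norm ?_
    filter_upwards [hF] with i hi using hi u
  exact ⟨T₀.mkContinuous 1 fun u => by rw [one_mul]; exact hb u, hb, hg⟩

end StrongLimits

/-! ### Exponentials of bounded operators -/

section Exponential

variable [CompleteSpace X]

theorem exp_smul_sub_smul_one (B : X →L[ℝ] X) (c t : ℝ) :
    NormedSpace.exp (t • (B - c • (1 : X →L[ℝ] X)))
      = Real.exp (-(c * t)) • NormedSpace.exp (t • B) := by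
  let _ : NormedAlgebra ℚ (X →L[ℝ] X) := NormedAlgebra.restrictScalars ℚ ℝ _
  have h1 : t • (B - c • (1 : X →L[ℝ] X)) = algebraMap ℝ (X →L[ℝ] X) (-(c * t)) + t • B := by
    rw [Algebra.algebraMap_eq_smul_one, smul_sub, smul_smul, neg_smul, mul_comm t c]
    abel
  rw [h1, NormedSpace.exp_add_of_commute (Algebra.commutes _ _), ← NormedSpace.algebraMap_exp_comm,
    Real.exp_eq_exp_ℝ, Algebra.algebraMap_eq_smul_one, smul_mul_assoc, one_mul]

theorem norm_exp_apply_le (B : X →L[ℝ] X) {c : ℝ} (hc : ∀ u, ‖B u‖ ≤ c * ‖u‖) (u : X) :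
    ‖NormedSpace.exp B u‖ ≤ Real.exp c * ‖u‖ := by
  have h1 := (NormedSpace.exp_series_hasSum_exp' (𝕂 := ℝ) B).mapL
    (ContinuousLinearMap.apply ℝ X u)
  have h2 := (NormedSpace.exp_series_hasSum_exp' (𝕂 := ℝ) c).mul_right ‖u‖
  rw [← Real.exp_eq_exp_ℝ] at h2
  have h3 : ∀ n : ℕ, ‖(B ^ n) u‖ ≤ c ^ n * ‖u‖ := by
    intro n
    induction n with
    | zero => simp
    | succ n ih =>
      rcases eq_or_ne u 0 with rfl | hu
      · simp
      -- The sign of `c` is forced only when there is a nonzero vector, hence the case split.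
      have hc0 : 0 ≤ c := by
        have := (norm_nonneg _).trans (hc u)
        exact nonneg_of_mul_nonneg_left this (norm_pos_iff.2 hu)
      rw [pow_succ', pow_succ']
      calc ‖B ((B ^ n) u)‖ ≤ c * ‖(B ^ n) u‖ := hc _
        _ ≤ c * (c ^ n * ‖u‖) := by gcongr
        _ = c * c ^ n * ‖u‖ := by ring
  refine h1.norm_le_of_bounded h2 fun n => ?_
  simp only [ContinuousLinearMap.apply_apply, smul_apply, norm_smul,
    smul_eq_mul, norm_inv, RCLike.norm_natCast]
  rw [mul_assoc]
  gcongr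
  exact h3 n

theorem hasDerivAt_exp_smul_apply (B : X →L[ℝ] X) (u : X) (t : ℝ) :
    HasDerivAt (fun s : ℝ => NormedSpace.exp (s • B) u) (NormedSpace.exp (t • B) (B u)) t :=
  (ContinuousLinearMap.apply ℝ X u).hasFDerivAt.comp_hasDerivAt t
    (hasDerivAt_exp_smul_const B t)

/-- The path `s ↦ exp(sB) exp((t-s)C)` joins the two exponentials, and its derivative is a product
of contractions applied to `B - C`; commutativity allows that order of factors. -/
theorem norm_exp_sub_exp_le {B C : X →L[ℝ] X} (hBC : Commute B C)
    (hB : ∀ s : ℝ, 0 ≤ s → ∀ u, ‖NormedSpace.exp (s • B) u‖ ≤ ‖u‖)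
    (hC : ∀ s : ℝ, 0 ≤ s → ∀ u, ‖NormedSpace.exp (s • C) u‖ ≤ ‖u‖) {t : ℝ} (ht : 0 ≤ t) (u : X) :
    ‖NormedSpace.exp (t • B) u - NormedSpace.exp (t • C) u‖ ≤ t * ‖B u - C u‖ := by
  have h1 : ∀ s : ℝ, HasDerivAt
      (fun s : ℝ => NormedSpace.exp (s • B) * NormedSpace.exp ((t - s) • C))
      (NormedSpace.exp (s • B) * NormedSpace.exp ((t - s) • C) * (B - C)) s := by
    intro s
    have h2 : HasDerivAt (fun s : ℝ => NormedSpace.exp ((t - s) • C))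
        (-(NormedSpace.exp ((t - s) • C) * C)) s := by
      refine ((hasDerivAt_exp_smul_const C (t - s)).scomp s
        ((hasDerivAt_id s).const_sub t)).congr_deriv ?_
      rw [neg_one_smul]
    refine ((hasDerivAt_exp_smul_const B s).mul h2).congr_deriv ?_
    have h3 : Commute B (NormedSpace.exp ((t - s) • C)) :=
      (hBC.smul_right (t - s)).exp_right
    rw [mul_assoc, h3.eq]
    noncomm_ring
  have h2 : ∀ s ∈ Set.Icc (0 : ℝ) t, HasDerivWithinAt
      (fun s : ℝ => (NormedSpace.exp (s • B) * NormedSpace.exp ((t - s) • C)) u)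
      ((NormedSpace.exp (s • B) * NormedSpace.exp ((t - s) • C) * (B - C)) u)
      (Set.Icc 0 t) s := fun s _ =>
    ((ContinuousLinearMap.apply ℝ X u).hasFDerivAt.comp_hasDerivAt s (h1 s)).hasDerivWithinAt
  have h3 := norm_image_sub_le_of_norm_deriv_le_segment' h2 (C := ‖B u - C u‖)
    (fun s hs => (hB s hs.1 _).trans (hC _ (sub_nonneg.2 hs.2.le) _)) t ⟨ht, le_rfl⟩
  simpa [mul_comm] using h3

end Exponential

/-! ### The Yosida approximation -/

/-- The Yosida approximation `λ² R(λ) - λ`. -/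
def yosida (R : ℝ → X →L[ℝ] X) (lam : ℝ) : X →L[ℝ] X := lam ^ 2 • R lam - lam • 1

variable {A : X →ₗ.[ℝ] X} {R : ℝ → X →L[ℝ] X}

theorem IsMAccretive.mul_norm_resolvent_le (hA : IsMAccretive A) {lam : ℝ} (hl : 0 < lam)
    {R : X →L[ℝ] X} (hR : IsResolvent A lam R) (u : X) : lam * ‖R u‖ ≤ ‖u‖ := by
  obtain ⟨w, hw, hw'⟩ := hR.1 u
  rw [← hw, ← hw']
  exact (hA lam hl).1 w

theorem resolvent_identity {lam mu : ℝ} {R R' : X →L[ℝ] X} (hR : IsResolvent A lam R)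
    (hR' : IsResolvent A mu R') (u : X) : R u + (lam - mu) • R (R' u) = R' u := by
  obtain ⟨w, hw, hw'⟩ := hR'.1 u
  rw [← hw, ← map_smul, ← map_add, ← hw']
  convert hR.2 w using 2
  rw [sub_smul]
  abel

theorem commute_resolvent {lam mu : ℝ} {R R' : X →L[ℝ] X} (hR : IsResolvent A lam R)
    (hR' : IsResolvent A mu R') : Commute R R' := by
  rcases eq_or_ne lam mu with rfl | hne
  · rw [hR.unique hR']
  ext u
  have h1 := resolvent_identity hR hR' u
  have h2 := resolvent_identity hR' hR u
  have h3 : (lam - mu) • (R (R' u) - R' (R u)) = 0 := by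
    have h4 : (lam - mu) • R (R' u) = R' u - R u := by rw [eq_sub_iff_add_eq, add_comm]; exact h1
    have h5 : (mu - lam) • R' (R u) = R u - R' u := by
      rw [eq_sub_iff_add_eq, add_comm]; exact h2
    rw [smul_sub, h4, ← neg_sub mu lam, neg_smul, h5]
    abel
  exact sub_eq_zero.1 ((smul_eq_zero.1 h3).resolve_left (sub_ne_zero.2 hne))

section Yosida

variable (hA : IsMAccretive A) (hR : ∀ lam : ℝ, 0 < lam → IsResolvent A lam (R lam))
include hA hR

omit hA in
theorem commute_yosida {lam mu : ℝ} (hl : 0 < lam) (hm : 0 < mu) :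
    Commute (yosida R lam) (yosida R mu) := by
  have h1 : Commute (lam ^ 2 • R lam) (mu ^ 2 • R mu) :=
    ((commute_resolvent (hR lam hl) (hR mu hm)).smul_left _).smul_right _
  have h2 : ∀ (c : ℝ) (B : X →L[ℝ] X), Commute B (c • (1 : X →L[ℝ] X)) :=
    fun c B => (Commute.one_right B).smul_right c
  exact (h1.sub_right (h2 _ _)).sub_left ((h2 _ _).symm)

theorem norm_exp_yosida_le [CompleteSpace X] {lam t : ℝ} (hl : 0 < lam) (ht : 0 ≤ t) (u : X) :
    ‖NormedSpace.exp (t • yosida R lam) u‖ ≤ ‖u‖ := by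
  have h1 : ∀ u, ‖(t • lam ^ 2 • R lam) u‖ ≤ lam * t * ‖u‖ := by
    intro u
    have h2 := hA.mul_norm_resolvent_le hl (hR lam hl) u
    rw [smul_apply, smul_apply, norm_smul, norm_smul, Real.norm_of_nonneg ht,
      Real.norm_of_nonneg (by positivity)]
    calc t * (lam ^ 2 * ‖R lam u‖) = lam * t * (lam * ‖R lam u‖) := by ring
      _ ≤ lam * t * ‖u‖ := by gcongr
  rw [yosida, exp_smul_sub_smul_one, smul_apply, norm_smul,
    Real.norm_of_nonneg (Real.exp_pos _).le]
  calc Real.exp (-(lam * t)) * ‖NormedSpace.exp (t • lam ^ 2 • R lam) u‖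
      ≤ Real.exp (-(lam * t)) * (Real.exp (lam * t) * ‖u‖) := by
        gcongr
        exact norm_exp_apply_le _ h1 u
    _ = ‖u‖ := by rw [← mul_assoc, ← Real.exp_add, neg_add_cancel, Real.exp_zero, one_mul]

theorem tendsto_smul_resolvent (hd : Dense (A.domain : Set X)) (u : X) :
    Tendsto (fun lam : ℝ => lam • R lam u) atTop (𝓝 u) := by
  have h1 : ∀ᶠ lam : ℝ in atTop, ∀ u, ‖(lam • R lam) u‖ ≤ ‖u‖ := by
    filter_upwards [eventually_gt_atTop 0] with lam hl u
    rw [smul_apply, norm_smul, Real.norm_of_nonneg hl.le]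
    exact hA.mul_norm_resolvent_le hl (hR lam hl) u
  refine tendsto_of_dense h1 (G := ContinuousLinearMap.id ℝ X) (fun u => le_rfl) hd ?_ u
  intro d hd
  have h2 : Tendsto (fun lam : ℝ => lam⁻¹ * ‖A ⟨d, hd⟩‖) atTop (𝓝 0) := by
    simpa using tendsto_inv_atTop_zero.mul_const ‖A ⟨d, hd⟩‖
  refine tendsto_iff_norm_sub_tendsto_zero.2
    (squeeze_zero' (Eventually.of_forall fun _ => norm_nonneg _) ?_ h2)
  filter_upwards [eventually_gt_atTop 0] with lam hl
  have h3 := (hR lam hl).2 ⟨d, hd⟩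
  have h4 := hA.mul_norm_resolvent_le hl (hR lam hl) (A ⟨d, hd⟩)
  rw [map_add, map_smul] at h3
  have h5 : (lam • R lam) d - (ContinuousLinearMap.id ℝ X) d = -R lam (A ⟨d, hd⟩) := by
    rw [smul_apply, ContinuousLinearMap.id_apply, sub_eq_iff_eq_add, neg_add_eq_sub, eq_sub_iff_add_eq]
    exact h3
  rw [h5, norm_neg, inv_mul_eq_div, le_div_iff₀ hl, mul_comm]
  exact h4

/-- On `D(A)` the approximation equals `-λ R(λ) A`, and `λ R(λ)` tends strongly to the identity. -/
theorem tendsto_yosida (hd : Dense (A.domain : Set X)) (w : A.domain) :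
    Tendsto (fun lam : ℝ => yosida R lam w) atTop (𝓝 (-(A w))) := by
  refine (tendsto_smul_resolvent hA hR hd (A w)).neg.congr' ?_
  filter_upwards [eventually_gt_atTop 0] with lam hl
  have h3 := (hR lam hl).2 w
  rw [map_add, map_smul] at h3
  have h4 : R lam (A w) = (w : X) - lam • R lam w := eq_sub_of_add_eq' h3
  rw [h4, yosida]
  simp only [sub_apply, smul_apply, ContinuousLinearMap.one_def, ContinuousLinearMap.id_apply,
    smul_sub, smul_smul]
  rw [pow_two]
  abel

end Yosida

/-- The Hille–Yosida theorem for contraction semigroups, with the Yosida approximation. -/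
theorem IsMAccretive.exists_semigroup [CompleteSpace X] (hA : IsMAccretive A)
    (hd : Dense (A.domain : Set X)) (hR : ∀ lam : ℝ, 0 < lam → IsResolvent A lam (R lam)) :
    ∃ T : ℝ → X →L[ℝ] X, IsContractionSemigroup T ∧ IsGenerator T (-A) ∧
      ∀ t, 0 < t → ∀ u, Tendsto (fun lam : ℝ => NormedSpace.exp (t • yosida R lam) u) atTop
        (𝓝 (T t u)) := by
  have hcontr : ∀ t : ℝ, 0 ≤ t → ∀ᶠ lam : ℝ in atTop, ∀ u,
      ‖NormedSpace.exp (t • yosida R lam) u‖ ≤ ‖u‖ := by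
    intro t ht
    filter_upwards [eventually_gt_atTop 0] with lam hl u
    exact norm_exp_yosida_le hA hR hl ht u
  have hlim : ∀ t : ℝ, 0 ≤ t → ∀ u, ∃ v,
      Tendsto (fun lam : ℝ => NormedSpace.exp (t • yosida R lam) u) atTop (𝓝 v) := by
    intro t ht
    refine exists_tendsto_of_dense (hcontr t ht) hd fun d hd' => ?_
    rw [← cauchy_map_iff_exists_tendsto, Metric.cauchy_iff]
    refine ⟨inferInstance, fun ε hε => ?_⟩
    have h1 := (tendsto_yosida hA hR hd ⟨d, hd'⟩).cauchy_map
    -- The difference of the exponentials costs a factor `t`; `t + 1` avoids dividing by zero at `t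
    -- = 0`.
    obtain ⟨s, hs, hs'⟩ := (Metric.cauchy_iff.1 h1).2 (ε / (t + 1)) (by positivity)
    refine ⟨_, image_mem_map (inter_mem hs (eventually_gt_atTop 0)), ?_⟩
    rintro _ ⟨i, ⟨hi, hi0 : 0 < i⟩, rfl⟩ _ ⟨j, ⟨hj, hj0 : 0 < j⟩, rfl⟩
    have h2 := hs' _ hi _ hj
    rw [dist_eq_norm, lt_div_iff₀ (by positivity)] at h2
    rw [dist_eq_norm]
    have h3 := norm_exp_sub_exp_le (commute_yosida hR hi0 hj0)
      (fun s hs => norm_exp_yosida_le hA hR hi0 hs) (fun s hs => norm_exp_yosida_le hA hR hj0 hs)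
      ht d
    refine h3.trans_lt (lt_of_le_of_lt ?_ h2)
    nlinarith [norm_nonneg (yosida R i d - yosida R j d)]
  have hT : ∀ t : ℝ, ∃ T : X →L[ℝ] X, 0 ≤ t → (∀ u, ‖T u‖ ≤ ‖u‖) ∧
      ∀ u, Tendsto (fun lam : ℝ => NormedSpace.exp (t • yosida R lam) u) atTop (𝓝 (T u)) := by
    intro t
    rcases lt_or_ge t 0 with ht | ht
    · exact ⟨0, fun h => absurd ht h.not_gt⟩
    · obtain ⟨T, hT⟩ := exists_clm_of_tendsto (hcontr t ht) (hlim t ht)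
      exact ⟨T, fun _ => hT⟩
  choose T hT using hT
  have hTn := fun t ht => (hT t ht).1
  have hTl := fun t ht => (hT t ht).2
  have hadd : ∀ s t, 0 < s → 0 < t → T (s + t) = T s ∘L T t := by
    let _ : NormedAlgebra ℚ (X →L[ℝ] X) := NormedAlgebra.restrictScalars ℚ ℝ _
    intro s t hs ht
    ext u
    refine tendsto_nhds_unique (hTl (s + t) (by positivity) u) ?_
    refine (tendsto_apply_of_contraction (hcontr s hs.le) (hTl t ht.le u)
      (hTl s hs.le (T t u))).congr fun lam => ?_
    rw [add_smul, NormedSpace.exp_add_of_commute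
      (((Commute.refl (yosida R lam)).smul_left s).smul_right t)]
    rfl
  have hzero : ∀ u, Tendsto (fun t => T t u) (𝓝[>] 0) (𝓝 u) := by
    have h1 : ∀ᶠ t in 𝓝[>] (0 : ℝ), ∀ u, ‖T t u‖ ≤ ‖u‖ := by
      filter_upwards [self_mem_nhdsWithin] with t (ht : 0 < t) using hTn t ht.le
    refine tendsto_of_dense h1 (G := ContinuousLinearMap.id ℝ X) (fun u => le_rfl) hd ?_
    intro d hd'
    have h2 : Tendsto (fun t : ℝ => t * ‖A ⟨d, hd'⟩‖) (𝓝[>] 0) (𝓝 0) := by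
      have : Continuous fun t : ℝ => t * ‖A ⟨d, hd'⟩‖ := by fun_prop
      simpa using (this.tendsto 0).mono_left nhdsWithin_le_nhds
    refine tendsto_iff_norm_sub_tendsto_zero.2
      (squeeze_zero' (Eventually.of_forall fun _ => norm_nonneg _) ?_ h2)
    filter_upwards [self_mem_nhdsWithin] with t (ht : 0 < t)
    have h3 := ((tendsto_yosida hA hR hd ⟨d, hd'⟩).norm.const_mul t)
    rw [norm_neg] at h3
    refine le_of_tendsto_of_tendsto ((hTl t ht.le d).sub_const d).norm h3 ?_
    filter_upwards [eventually_gt_atTop 0] with lam hl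
    -- The identity is the exponential of the zero operator, so the comparison gives `‖exp(tY) d -
    -- d‖ ≤ t ‖Y d‖`.
    simpa using norm_exp_sub_exp_le (Commute.zero_right (yosida R lam))
      (fun s hs => norm_exp_yosida_le hA hR hl hs) (fun s hs u => by simp) ht.le d
  have hsg : IsContractionSemigroup T := by
    refine ⟨⟨hadd, hzero⟩, fun t ht => ?_⟩
    exact (T t).opNorm_le_bound zero_le_one fun u => by rw [one_mul]; exact hTn t ht.le u
  refine ⟨T, hsg, hsg.isGenerator_of_surjective (fun w => ?_) fun u => ?_, fun t ht => hTl t ht.le⟩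
  -- The integrated equation `T_t w - w = ∫₀ᵗ T_s (-A w) ds`, a limit of the same identity for the
  -- exponentials. Rescaling parameter `0` means the plain orbit.
  · have h1 : ∀ t : ℝ, 0 < t →
        ∫ s in (0 : ℝ)..t, expOrbit T 0 (-(A w)) s = T t (w : X) - w := by
      intro t ht
      have hcont : ∀ (lam : ℝ) (v : X),
          Continuous fun s : ℝ => NormedSpace.exp (s • yosida R lam) v := fun lam v =>
        continuous_iff_continuousAt.2 fun s => (hasDerivAt_exp_smul_apply _ v s).continuousAt
      have h2 : ∀ lam : ℝ,
          ∫ s in (0 : ℝ)..t, NormedSpace.exp (s • yosida R lam) (yosida R lam w)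
            = NormedSpace.exp (t • yosida R lam) (w : X) - w := by
        intro lam
        rw [intervalIntegral.integral_eq_sub_of_hasDerivAt
          (fun s _ => hasDerivAt_exp_smul_apply (yosida R lam) (w : X) s)
          ((hcont lam _).intervalIntegrable _ _)]
        simp
      have hy := tendsto_yosida hA hR hd w
      have h3 : Tendsto (fun lam : ℝ =>
          ∫ s in (0 : ℝ)..t, NormedSpace.exp (s • yosida R lam) (yosida R lam w)) atTop
          (𝓝 (∫ s in (0 : ℝ)..t, expOrbit T 0 (-(A w)) s)) := by
        refine intervalIntegral.tendsto_integral_filter_of_dominated_convergence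
          (fun _ => ‖A w‖ + 1) ?_ ?_ (by simp) ?_
        · exact Eventually.of_forall fun lam => (hcont lam _).aestronglyMeasurable
        · have h4 : ∀ᶠ lam : ℝ in atTop, ‖yosida R lam w‖ < ‖A w‖ + 1 :=
            hy.norm.eventually_lt_const (by rw [norm_neg]; linarith)
          filter_upwards [h4, eventually_gt_atTop 0] with lam hlam hl
          refine Eventually.of_forall fun s hs => ?_
          rw [Set.uIoc_of_le ht.le] at hs
          exact (norm_exp_yosida_le hA hR hl hs.1.le _).trans hlam.le
        · refine Eventually.of_forall fun s hs => ?_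
          rw [Set.uIoc_of_le ht.le] at hs
          have h5 : expOrbit T 0 (-(A w)) s = T s (-(A w)) := by
            simp [expOrbit, extendId_of_pos T hs.1]
          rw [h5]
          exact tendsto_apply_of_contraction (hcontr s hs.1.le) hy (hTl s hs.1.le _)
      simp_rw [h2] at h3
      exact tendsto_nhds_unique h3 ((hTl t ht.le w).sub_const _)
    refine (hsg.tendsto_average_expOrbit 0 (-(A w))).congr' ?_
    filter_upwards [self_mem_nhdsWithin] with t (ht : 0 < t)
    rw [h1 t ht]
  · simpa using (hA 1 one_pos).2 u

end HilleYosida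

/-! ### Ordered spaces with norm additive on the positive cone -/

section OrderedSpaces

variable {X : Type*} [NormedAddCommGroup X] [NormedSpace ℝ X] [PartialOrder X]
  [IsOrderedAddMonoid X]

/-- The norm is additive on the positive cone, where it is given by the functional `tr`, and every
element is a difference of positive elements whose norms add up. -/
structure IsAdditiveNorm (tr : X →L[ℝ] ℝ) : Prop where
  norm_eq : ∀ u, 0 ≤ u → ‖u‖ = tr u
  exists_decomp : ∀ u, ∃ p q : X, 0 ≤ p ∧ 0 ≤ q ∧ u = p - q ∧ ‖p‖ + ‖q‖ ≤ ‖u‖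

namespace IsAdditiveNorm

variable {tr : X →L[ℝ] ℝ} (htr : IsAdditiveNorm tr)
include htr

theorem nonneg {u : X} (hu : 0 ≤ u) : 0 ≤ tr u := by
  rw [← htr.norm_eq u hu]
  exact norm_nonneg u

theorem mono {u v : X} (h : u ≤ v) : tr u ≤ tr v := by
  have := htr.nonneg (sub_nonneg.2 h)
  rwa [map_sub, sub_nonneg] at this

theorem le_norm (u : X) : tr u ≤ ‖u‖ := by
  obtain ⟨p, q, hp, hq, hu, h⟩ := htr.exists_decomp u
  have h1 : tr u = tr p - tr q := by rw [hu, map_sub]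
  rw [htr.norm_eq p hp, htr.norm_eq q hq] at h
  linarith [htr.nonneg hq]

/-- A linear map is bounded by its bound on the positive cone. -/
theorem norm_map_le (B : X →ₗ[ℝ] X) {c : ℝ} (hc : 0 ≤ c) (h : ∀ u, 0 ≤ u → ‖B u‖ ≤ c * ‖u‖)
    (u : X) : ‖B u‖ ≤ c * ‖u‖ := by
  obtain ⟨p, q, hp, hq, hu, hn⟩ := htr.exists_decomp u
  calc ‖B u‖ = ‖B p - B q‖ := by rw [hu, map_sub]
    _ ≤ c * ‖p‖ + c * ‖q‖ := (norm_sub_le _ _).trans (add_le_add (h p hp) (h q hq))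
    _ = c * (‖p‖ + ‖q‖) := by ring
    _ ≤ c * ‖u‖ := by gcongr

/-- Strong convergence of linear maps may be checked on the positive cone. -/
theorem tendsto_of_nonneg {ι : Type*} {l : Filter ι} {F : ι → X →L[ℝ] X} {G : X →L[ℝ] X}
    (h : ∀ u, 0 ≤ u → Tendsto (fun i => F i u) l (𝓝 (G u))) (u : X) :
    Tendsto (fun i => F i u) l (𝓝 (G u)) := by
  obtain ⟨p, q, hp, hq, rfl, -⟩ := htr.exists_decomp u
  simpa only [map_sub] using (h p hp).sub (h q hq)

theorem exists_tendsto_of_nonneg {ι : Type*} {l : Filter ι} {F : ι → X →L[ℝ] X}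
    (h : ∀ u, 0 ≤ u → ∃ v, Tendsto (fun i => F i u) l (𝓝 v)) (u : X) :
    ∃ v, Tendsto (fun i => F i u) l (𝓝 v) := by
  obtain ⟨p, q, hp, hq, rfl, -⟩ := htr.exists_decomp u
  obtain ⟨v, hv⟩ := h p hp
  obtain ⟨w, hw⟩ := h q hq
  exact ⟨v - w, by simpa only [map_sub] using hv.sub hw⟩

/-- Since `r - p ≥ 0`, its norm is `tr r - tr p ≤ tr (u - p) ≤ ‖u - p‖`. Thus control of a lower
bound `p` near `u` controls everything above it of no larger trace. -/
theorem norm_sub_le_two_mul {u p r : X} (hpr : p ≤ r) (hr : tr r ≤ tr u) :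
    ‖r - u‖ ≤ 2 * ‖p - u‖ := by
  have h1 : ‖r - p‖ ≤ ‖p - u‖ := by
    rw [htr.norm_eq _ (sub_nonneg.2 hpr), norm_sub_rev p u]
    refine le_trans ?_ (htr.le_norm (u - p))
    rw [map_sub, map_sub]
    linarith
  linarith [norm_sub_le_norm_sub_add_norm_sub r p u]

/-- Monotone nets with bounded trace converge in norm. -/
theorem exists_tendsto_of_monotone [CompleteSpace X] {J : Type*} [Preorder J] [IsDirectedOrder J]
    [Nonempty J] {f : J → X} (hf : Monotone f) {C : ℝ} (hC : ∀ α, tr (f α) ≤ C) :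
    ∃ v, Tendsto f atTop (𝓝 v) := by
  have h1 : Monotone fun α => tr (f α) := fun α β hab => htr.mono (hf hab)
  have h2 : Tendsto (fun α => tr (f α)) atTop (𝓝 (⨆ α, tr (f α))) :=
    tendsto_atTop_ciSup h1 ⟨C, by rintro _ ⟨α, rfl⟩; exact hC α⟩
  have hle : ∀ α, tr (f α) ≤ ⨆ α, tr (f α) :=
    le_ciSup ⟨C, by rintro _ ⟨α, rfl⟩; exact hC α⟩
  rw [← cauchy_map_iff_exists_tendsto, Metric.cauchy_iff]
  refine ⟨inferInstance, fun ε hε => ?_⟩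
  -- Beyond `α₀` the trace can grow by less than `ε / 2`, and this growth is the norm of the
  -- increment.
  obtain ⟨α₀, hα₀⟩ := (h2.eventually (lt_mem_nhds
    (by linarith : (⨆ α, tr (f α)) - ε / 2 < ⨆ α, tr (f α)))).exists
  refine ⟨_, image_mem_map (Ici_mem_atTop α₀), ?_⟩
  have key : ∀ α, α₀ ≤ α → dist (f α) (f α₀) < ε / 2 := by
    intro α hα
    rw [dist_eq_norm, htr.norm_eq _ (sub_nonneg.2 (hf hα)), map_sub]
    linarith [hle α]
  rintro _ ⟨α, hα, rfl⟩ _ ⟨β, hβ, rfl⟩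
  linarith [key α hα, key β hβ, dist_triangle_right (f α) (f β) (f α₀)]

end IsAdditiveNorm

/-! ### Positivity and monotonicity of exponentials -/

section Exponential

variable [IsOrderedModule ℝ X] [OrderClosedTopology X] [CompleteSpace X]

theorem map_mono_of_nonneg {B : X →L[ℝ] X} (hB : ∀ u, 0 ≤ u → 0 ≤ B u) {u v : X} (h : u ≤ v) :
    B u ≤ B v := by
  have := hB _ (sub_nonneg.2 h)
  rwa [map_sub, sub_nonneg] at this

theorem pow_apply_nonneg {B : X →L[ℝ] X} (hB : ∀ u, 0 ≤ u → 0 ≤ B u) (n : ℕ) {u : X}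
    (hu : 0 ≤ u) : 0 ≤ (B ^ n) u := by
  induction n with
  | zero => simpa using hu
  | succ n ih =>
    rw [pow_succ']
    exact hB _ ih

theorem hasSum_exp_apply (B : X →L[ℝ] X) (u : X) :
    HasSum (fun n : ℕ => ((n.factorial : ℝ)⁻¹ • (B ^ n) u)) (NormedSpace.exp B u) :=
  (NormedSpace.exp_series_hasSum_exp' (𝕂 := ℝ) B).mapL (ContinuousLinearMap.apply ℝ X u)

theorem exp_apply_nonneg {B : X →L[ℝ] X} (hB : ∀ u, 0 ≤ u → 0 ≤ B u) {u : X} (hu : 0 ≤ u) :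
    0 ≤ NormedSpace.exp B u :=
  (hasSum_exp_apply B u).nonneg fun n =>
    smul_nonneg (by positivity) (pow_apply_nonneg hB n hu)

theorem exp_apply_mono {B C : X →L[ℝ] X} (hB : ∀ u, 0 ≤ u → 0 ≤ B u)
    (hBC : ∀ u, 0 ≤ u → B u ≤ C u) {u : X} (hu : 0 ≤ u) :
    NormedSpace.exp B u ≤ NormedSpace.exp C u := by
  have hC : ∀ u, 0 ≤ u → 0 ≤ C u := fun u hu => (hB u hu).trans (hBC u hu)
  have h1 : ∀ n : ℕ, (B ^ n) u ≤ (C ^ n) u := by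
    intro n
    induction n with
    | zero => simp
    | succ n ih =>
      rw [pow_succ', pow_succ']
      exact (hBC _ (pow_apply_nonneg hB n hu)).trans (map_mono_of_nonneg hC ih)
  exact hasSum_le (fun n => smul_le_smul_of_nonneg_left (h1 n) (by positivity))
    (hasSum_exp_apply B u) (hasSum_exp_apply C u)

/-- The negative term `-λ` only contributes the scalar `e^{-λt}`; what remains is a power series in
the positive operator `R(λ)`. -/
theorem exp_yosida_apply_nonneg {R : ℝ → X →L[ℝ] X} {lam t : ℝ}
    (hR : ∀ u, 0 ≤ u → 0 ≤ R lam u) (ht : 0 ≤ t) {u : X} (hu : 0 ≤ u) :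
    0 ≤ NormedSpace.exp (t • yosida R lam) u := by
  rw [yosida, exp_smul_sub_smul_one]
  exact smul_nonneg (Real.exp_pos _).le (exp_apply_nonneg
    (fun v hv => smul_nonneg ht (smul_nonneg (sq_nonneg lam) (hR v hv))) hu)

theorem exp_yosida_apply_mono {R R' : ℝ → X →L[ℝ] X} {lam t : ℝ}
    (hR : ∀ u, 0 ≤ u → 0 ≤ R lam u) (hRR : ∀ u, 0 ≤ u → R lam u ≤ R' lam u) (ht : 0 ≤ t) {u : X}
    (hu : 0 ≤ u) :
    NormedSpace.exp (t • yosida R lam) u ≤ NormedSpace.exp (t • yosida R' lam) u := by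
  rw [yosida, yosida, exp_smul_sub_smul_one, exp_smul_sub_smul_one]
  exact smul_le_smul_of_nonneg_left (exp_apply_mono
    (fun v hv => smul_nonneg ht (smul_nonneg (sq_nonneg lam) (hR v hv)))
    (fun v hv => smul_le_smul_of_nonneg_left
      (smul_le_smul_of_nonneg_left (hRR v hv) (sq_nonneg lam)) ht) hu) (Real.exp_pos _).le

end Exponential

/-! ### Positive perturbations of the generator -/

section Perturbation

variable [IsOrderedModule ℝ X] [OrderClosedTopology X] [CompleteSpace X]

theorem extendId_apply_nonneg {S : ℝ → X →L[ℝ] X} (hpos : ∀ t, 0 < t → ∀ u, 0 ≤ u → 0 ≤ S t u)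
    (t : ℝ) {u : X} (hu : 0 ≤ u) : 0 ≤ extendId S t u := by
  rcases lt_or_ge 0 t with ht | ht
  · rw [extendId_of_pos S ht]
    exact hpos t ht u hu
  · simpa [extendId_of_nonpos S ht] using hu

theorem IsContractionSemigroup.resolvent_nonneg {S : ℝ → X →L[ℝ] X} {H : X →ₗ.[ℝ] X}
    (hS : IsContractionSemigroup S) (hpos : ∀ t, 0 < t → ∀ u, 0 ≤ u → 0 ≤ S t u)
    (hH : IsGenerator S (-H)) {lam : ℝ} (hl : 0 < lam) {R : X →L[ℝ] X} (hR : IsResolvent H lam R)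
    {u : X} (hu : 0 ≤ u) : 0 ≤ R u := by
  rw [hS.resolvent_apply_eq_laplace hH hl hR]
  exact MeasureTheory.integral_nonneg fun t =>
    smul_nonneg (Real.exp_pos _).le (extendId_apply_nonneg hpos t hu)

/-- The resolvent of a perturbation by a positive operator of relative bound less than one. -/
theorem IsContractionSemigroup.exists_resolvent_subPert {tr : X →L[ℝ] ℝ} (htr : IsAdditiveNorm tr)
    {S : ℝ → X →L[ℝ] X} {H : X →ₗ.[ℝ] X} (hS : IsContractionSemigroup S)
    (hpos : ∀ t, 0 < t → ∀ u, 0 ≤ u → 0 ≤ S t u) (hH : IsGenerator S (-H))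
    {K : H.domain →ₗ[ℝ] X} (hK : ∀ u : H.domain, 0 ≤ (u : X) → 0 ≤ K u)
    (hKH : ∀ u : H.domain, 0 ≤ (u : X) → tr (K u) ≤ tr (H u)) {a b : ℝ} (ha : 0 ≤ a)
    (hb : 0 ≤ b) (hb1 : b < 1)
    (hbound : ∀ u : H.domain, 0 ≤ (u : X) → tr (K u) ≤ a * tr (u : X) + b * tr (H u))
    {lam : ℝ} (hl : 0 < lam) :
    ∃ R : X →L[ℝ] X, IsResolvent (subPert H K) lam R ∧ (∀ u, 0 ≤ u → 0 ≤ R u) ∧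
      ∀ u, lam * ‖R u‖ ≤ ‖u‖ := by
  obtain ⟨R₀, hR₀, -⟩ := (hS.isMAccretive hH).exists_isResolvent hl
  have hR₀pos : ∀ u, 0 ≤ u → 0 ≤ R₀ u := fun u hu => hS.resolvent_nonneg hpos hH hl hR₀ hu
  have hdom : ∀ u, R₀ u ∈ H.domain := by
    intro u
    obtain ⟨w, hw, -⟩ := hR₀.1 u
    rw [← hw]
    exact w.2
  let D : X →ₗ[ℝ] H.domain := LinearMap.codRestrict H.domain R₀.toLinearMap hdom
  have hD : ∀ u, ((D u : H.domain) : X) = R₀ u := fun u => rfl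
  have hHD : ∀ u, lam • R₀ u + H (D u) = u := by
    intro u
    obtain ⟨w, hw, hw'⟩ := hR₀.1 u
    have h1 : D u = w := Subtype.ext hw.symm
    rw [h1, ← hw, hw']
  set c := a / lam with hc
  have hc0 : 0 ≤ c := by positivity
  -- With `x = tr (K R₀ u)`, `τ = tr u`, `ρ = λ tr (R₀ u)` one has `x ≤ τ - ρ` and `x ≤ c ρ + b (τ -
  -- ρ)`. Adding `c` times the first to the second eliminates `c ρ` and gives `(1 + c) x ≤ (c + b)
  -- τ`. So the factor is below one for every `λ > 0`, not only for large `λ`.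
  set q := (c + b) / (1 + c) with hq
  have hq0 : 0 ≤ q := by positivity
  have hq1 : q < 1 := by
    rw [hq, div_lt_one (by positivity)]
    linarith
  have hBpos : ∀ u, 0 ≤ u → 0 ≤ K (D u) := fun u hu => hK _ (hR₀pos u hu)
  have hB₀ : ∀ u, 0 ≤ u → ‖(K ∘ₗ D) u‖ ≤ q * ‖u‖ := by
    intro u hu
    have h1 : tr (H (D u)) = tr u - lam * tr (R₀ u) := by
      have h := congrArg tr (hHD u)
      rw [map_add, map_smul, smul_eq_mul] at h
      linarith
    have h2 := hKH (D u) (hR₀pos u hu)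
    have h3 := hbound (D u) (hR₀pos u hu)
    have h4 := htr.nonneg (hR₀pos u hu)
    rw [h1] at h2 h3
    rw [hD] at h3
    have h5 : a * tr (R₀ u) = c * (lam * tr (R₀ u)) := by
      rw [hc]
      field_simp
    rw [h5] at h3
    rw [LinearMap.comp_apply, htr.norm_eq _ (hBpos u hu), htr.norm_eq u hu, hq, div_mul_eq_mul_div,
      le_div_iff₀ (by positivity)]
    have h6 := mul_le_mul_of_nonneg_left h2 hc0
    have h7 : 0 ≤ b * (lam * tr (R₀ u)) := by positivity
    linarith
  let B : X →L[ℝ] X := (K ∘ₗ D).mkContinuous q (htr.norm_map_le _ hq0 hB₀)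
  have hB : ∀ u, B u = K (D u) := fun u => rfl
  have hBn : ‖B‖ < 1 := (LinearMap.mkContinuous_norm_le _ hq0 _).trans_lt hq1
  -- The Neumann series inverts `I - K R₀`, and its terms are positive.
  let N : X →L[ℝ] X := ∑' n : ℕ, B ^ n
  have hsum : Summable fun n : ℕ => B ^ n := summable_geometric_of_norm_lt_one hBn
  have hN1 : ∀ u, N u - B (N u) = u := fun u =>
    DFunLike.congr_fun (mul_neg_geom_series B hBn) u
  have hN2 : ∀ u, N (u - B u) = u := fun u =>
    DFunLike.congr_fun (geom_series_mul_neg B hBn) u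
  have hNpos : ∀ u, 0 ≤ u → 0 ≤ N u := fun u hu =>
    (hsum.hasSum.mapL (ContinuousLinearMap.apply ℝ X u)).nonneg fun n =>
      pow_apply_nonneg hBpos n hu
  have hRpos : ∀ u, 0 ≤ u → 0 ≤ (R₀ ∘L N) u := fun u hu => hR₀pos _ (hNpos u hu)
  have heq : ∀ u, lam • R₀ (N u) + (H (D (N u)) - K (D (N u))) = u := by
    intro u
    rw [← add_sub_assoc, hHD, ← hB, hN1]
  refine ⟨R₀ ∘L N, ⟨fun u => ⟨D (N u), rfl, heq u⟩, fun w => ?_⟩, hRpos, fun u => ?_⟩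
  · have h1 : R₀ (lam • (w : X) + H w) = w := hR₀.2 w
    have h2 : D (lam • (w : X) + H w) = w := Subtype.ext h1
    have h3 : lam • (w : X) + (subPert H K) w
        = (lam • (w : X) + H w) - B (lam • (w : X) + H w) := by
      rw [hB, h2, add_sub_assoc]
      rfl
    rw [h3, ContinuousLinearMap.comp_apply, hN2, h1]
  -- Take the trace of the resolvent equation and drop `tr (H w - K w) ≥ 0`.
  · have h1 : ∀ u, 0 ≤ u → ‖(lam • (R₀ ∘L N)) u‖ ≤ 1 * ‖u‖ := by
      intro u hu
      have h2 := congrArg tr (heq u)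
      rw [map_add, map_smul, map_sub, smul_eq_mul] at h2
      have h3 := hKH (D (N u)) (hRpos u hu)
      rw [one_mul, smul_apply, norm_smul, Real.norm_of_nonneg hl.le, htr.norm_eq _ (hRpos u hu),
        htr.norm_eq u hu, ContinuousLinearMap.comp_apply]
      linarith
    have h2 := htr.norm_map_le (lam • (R₀ ∘L N)).toLinearMap zero_le_one h1 u
    rw [one_mul] at h2
    simpa [norm_smul, abs_of_pos hl] using h2

/-- Second resolvent identity: `R' u = R u + R' (K' - K) R u`, whose last term is positive. -/
theorem resolvent_subPert_mono {H : X →ₗ.[ℝ] X} {K K' : H.domain →ₗ[ℝ] X} {lam : ℝ}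
    {R R' : X →L[ℝ] X} (hR : IsResolvent (subPert H K) lam R)
    (hR' : IsResolvent (subPert H K') lam R') (hRpos : ∀ u, 0 ≤ u → 0 ≤ R u)
    (hRpos' : ∀ u, 0 ≤ u → 0 ≤ R' u) (hKK : ∀ u : H.domain, 0 ≤ (u : X) → K u ≤ K' u) {u : X}
    (hu : 0 ≤ u) : R u ≤ R' u := by
  obtain ⟨w, hw, hw'⟩ := hR.1 u
  have hw0 : 0 ≤ (w : X) := hw ▸ hRpos u hu
  have h1 : u = (lam • (w : X) + (subPert H K') w) + (K' w - K w) := by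
    rw [← hw']
    change lam • (w : X) + (H w - K w) = lam • (w : X) + (H w - K' w) + (K' w - K w)
    abel
  have h2 : R' u = w + R' (K' w - K w) := by
    conv_lhs => rw [h1]
    rw [map_add, hR'.2 w]
  rw [← hw, h2]
  exact le_add_of_nonneg_right (hRpos' _ (sub_nonneg.2 (hKK w hw0)))

/-- Strong convergence on the positive part of the domain implies strong convergence. -/
theorem IsContractionSemigroup.tendsto_of_nonneg_domain {tr : X →L[ℝ] ℝ} (htr : IsAdditiveNorm tr)
    {S : ℝ → X →L[ℝ] X} {H : X →ₗ.[ℝ] X} (hS : IsContractionSemigroup S)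
    (hpos : ∀ t, 0 < t → ∀ u, 0 ≤ u → 0 ≤ S t u) (hH : IsGenerator S (-H)) {ι : Type*}
    {l : Filter ι} {F : ι → H.domain →ₗ[ℝ] X} {G : H.domain →ₗ[ℝ] X}
    (h : ∀ u : H.domain, 0 ≤ (u : X) → Tendsto (fun i => F i u) l (𝓝 (G u))) (u : H.domain) :
    Tendsto (fun i => F i u) l (𝓝 (G u)) := by
  obtain ⟨R, hR, -⟩ := (hS.isMAccretive hH).exists_isResolvent one_pos
  -- The parts of `u` itself need not lie in `D(H)`. Splitting `(I + H) u` and applying the positive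
  -- resolvent writes `u` as a difference of positive elements of `D(H)`.
  obtain ⟨p, q, hp, hq, hu, -⟩ := htr.exists_decomp ((1 : ℝ) • (u : X) + H u)
  obtain ⟨x, hx, -⟩ := hR.1 p
  obtain ⟨y, hy, -⟩ := hR.1 q
  have hxy : u = x - y := by
    apply Subtype.ext
    rw [AddSubgroupClass.coe_sub, hx, hy, ← map_sub, ← hu, hR.2]
  rw [hxy]
  simpa only [map_sub] using (h x (hx ▸ hS.resolvent_nonneg hpos hH one_pos hR hp)).sub
    (h y (hy ▸ hS.resolvent_nonneg hpos hH one_pos hR hq))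

end Perturbation

end OrderedSpaces

/-! ### Monotone nets of semigroups and their resolvents -/

section MonotoneLimits

variable {X : Type*} [NormedAddCommGroup X] [NormedSpace ℝ X] [PartialOrder X]
  [IsOrderedAddMonoid X] [IsOrderedModule ℝ X] [OrderClosedTopology X] [CompleteSpace X]
  {J : Type*} [Preorder J] [IsDirectedOrder J] [Nonempty J] {tr : X →L[ℝ] ℝ}

/-- A monotone net of positive contraction semigroups converges strongly to a positive contraction
semigroup. -/
theorem exists_semigroup_of_monotone (htr : IsAdditiveNorm tr) {Tα : J → ℝ → X →L[ℝ] X}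
    (hT : ∀ α, IsContractionSemigroup (Tα α))
    (hpos : ∀ α t, 0 < t → ∀ u, 0 ≤ u → 0 ≤ Tα α t u)
    (hmono : ∀ α β, α ≤ β → ∀ t, 0 < t → ∀ u, 0 ≤ u → Tα α t u ≤ Tα β t u) :
    ∃ T : ℝ → X →L[ℝ] X, (∀ t, 0 < t → ∀ u, Tendsto (fun α => Tα α t u) atTop (𝓝 (T t u))) ∧
      IsContractionSemigroup T ∧ ∀ t, 0 < t → ∀ u, 0 ≤ u → 0 ≤ T t u := by
  have htrle : ∀ α t, 0 < t → ∀ u, 0 ≤ u → tr (Tα α t u) ≤ tr u := by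
    intro α t ht u hu
    rw [← htr.norm_eq _ (hpos α t ht u hu), ← htr.norm_eq u hu]
    exact (hT α).norm_apply_le ht u
  have hcontr : ∀ t, 0 < t → ∀ᶠ α in (atTop : Filter J), ∀ u, ‖Tα α t u‖ ≤ ‖u‖ := fun t ht =>
    Eventually.of_forall fun α u => (hT α).norm_apply_le ht u
  have hT' : ∀ t : ℝ, ∃ T : X →L[ℝ] X, 0 < t → (∀ u, ‖T u‖ ≤ ‖u‖) ∧
      ∀ u, Tendsto (fun α => Tα α t u) atTop (𝓝 (T u)) := by
    intro t
    by_cases ht : 0 < t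
    · obtain ⟨T, hT⟩ := exists_clm_of_tendsto (hcontr t ht) (htr.exists_tendsto_of_nonneg
        fun u hu => htr.exists_tendsto_of_monotone (fun α β hab => hmono α β hab t ht u hu)
          fun α => htrle α t ht u hu)
      exact ⟨T, fun _ => hT⟩
    · exact ⟨0, fun h => absurd h ht⟩
  choose T hT' using hT'
  have hTn := fun t ht => (hT' t ht).1
  have hTl := fun t ht => (hT' t ht).2
  have hTpos : ∀ t, 0 < t → ∀ u, 0 ≤ u → 0 ≤ T t u := fun t ht u hu =>
    ge_of_tendsto' (hTl t ht u) fun α => hpos α t ht u hu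
  refine ⟨T, hTl, ⟨⟨fun s t hs ht => ?_, ?_⟩, fun t ht => ?_⟩, hTpos⟩
  · ext u
    refine tendsto_nhds_unique (hTl (s + t) (add_pos hs ht) u) ?_
    refine (tendsto_apply_of_contraction (hcontr s hs) (hTl t ht u) (hTl s hs (T t u))).congr
      fun α => ?_
    rw [(hT α).c0.add s t hs ht]
    rfl
  -- A single index suffices: `T_t u` lies above `T^α_t u` and has trace at most `tr u`.
  · refine htr.tendsto_of_nonneg (G := ContinuousLinearMap.id ℝ X) fun u hu => ?_
    obtain ⟨α⟩ := ‹Nonempty J›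
    have h1 : Tendsto (fun t => 2 * ‖Tα α t u - u‖) (𝓝[>] 0) (𝓝 0) := by
      simpa using (tendsto_iff_norm_sub_tendsto_zero.1 ((hT α).c0.tendsto_zero u)).const_mul 2
    refine tendsto_iff_norm_sub_tendsto_zero.2
      (squeeze_zero' (Eventually.of_forall fun _ => norm_nonneg _) ?_ h1)
    filter_upwards [self_mem_nhdsWithin] with t (ht : 0 < t)
    refine htr.norm_sub_le_two_mul ?_ ?_
    · refine ge_of_tendsto (hTl t ht u) ?_
      filter_upwards [eventually_ge_atTop α] with β hβ using hmono α β hβ t ht u hu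
    · rw [← htr.norm_eq _ (hTpos t ht u hu)]
      exact (hTn t ht u).trans_eq (htr.norm_eq u hu)
  · exact (T t).opNorm_le_bound zero_le_one fun u => by rw [one_mul]; exact hTn t ht u

/-- The resolvents of a monotone net of semigroups converge to the resolvent of the limit. -/
theorem tendsto_resolvent_of_monotone (htr : IsAdditiveNorm tr) {Tα : J → ℝ → X →L[ℝ] X}
    (hT : ∀ α, IsContractionSemigroup (Tα α))
    (hpos : ∀ α t, 0 < t → ∀ u, 0 ≤ u → 0 ≤ Tα α t u)
    (hmono : ∀ α β, α ≤ β → ∀ t, 0 < t → ∀ u, 0 ≤ u → Tα α t u ≤ Tα β t u)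
    {T : ℝ → X →L[ℝ] X} (hTl : ∀ t, 0 < t → ∀ u, Tendsto (fun α => Tα α t u) atTop (𝓝 (T t u)))
    {Aα : J → X →ₗ.[ℝ] X} {L : X →ₗ.[ℝ] X}
    (hA : ∀ α, IsGenerator (Tα α) (-(Aα α))) (hL : IsGenerator T (-L)) {lam : ℝ} (hl : 0 < lam)
    {Rα : J → X →L[ℝ] X} {R : X →L[ℝ] X} (hRα : ∀ α, IsResolvent (Aα α) lam (Rα α))
    (hR : IsResolvent L lam R)
    (hRpos : ∀ α u, 0 ≤ u → 0 ≤ Rα α u)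
    (hRmono : ∀ α β, α ≤ β → ∀ u, 0 ≤ u → Rα α u ≤ Rα β u) (u : X) :
    Tendsto (fun α => Rα α u) atTop (𝓝 (R u)) := by
  refine htr.tendsto_of_nonneg (fun u hu => ?_) u
  have hbound : ∀ α, tr (Rα α u) ≤ lam⁻¹ * ‖u‖ := by
    intro α
    rw [← htr.norm_eq _ (hRpos α u hu), inv_mul_eq_div, le_div_iff₀ hl, mul_comm]
    exact ((hT α).isMAccretive (hA α)).mul_norm_resolvent_le hl (hRα α) u
  obtain ⟨w, hw⟩ := htr.exists_tendsto_of_monotone (fun α β hab => hRmono α β hab u hu) hbound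
  -- Dominated convergence in the Laplace integral can fail along a net, so the limit `w` of the
  -- resolvents is instead shown to solve `(λ + L) w = u`.
  suffices hgen : HasGen T w (lam • w - u) by
    obtain ⟨x, hx, hx'⟩ := hL.exists_of_hasGen hgen
    have h1 : lam • (x : X) + L x = u := by
      rw [hx, neg_eq_iff_eq_neg.1 hx']
      abel
    have h2 := hR.2 x
    rw [h1, hx] at h2
    rwa [h2]
  -- All orbits with `β ≥ α` are continuous at `0` uniformly in `β`.
  have horbit : ∀ α β, α ≤ β → ∀ s, 0 < s →
      ‖expOrbit (Tα β) lam u s - u‖ ≤ 2 * ‖expOrbit (Tα α) lam u s - u‖ := by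
    intro α β hab s hs
    have he : Real.exp (-(lam * s)) ≤ 1 := Real.exp_le_one_iff.2 (by nlinarith)
    simp only [expOrbit, extendId_of_pos _ hs]
    refine htr.norm_sub_le_two_mul
      (smul_le_smul_of_nonneg_left (hmono α β hab s hs u hu) (Real.exp_pos _).le) ?_
    have h1 : tr (Tα β s u) ≤ tr u := by
      rw [← htr.norm_eq _ (hpos β s hs u hu), ← htr.norm_eq u hu]
      exact (hT β).norm_apply_le hs u
    rw [map_smul, smul_eq_mul]
    exact (mul_le_of_le_one_left (htr.nonneg (hpos β s hs u hu)) he).trans h1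
  have hint : ∀ t, 0 < t → Tendsto (fun α => ∫ s in (0 : ℝ)..t, expOrbit (Tα α) lam u s) atTop
      (𝓝 (w - Real.exp (-(lam * t)) • T t w)) := by
    intro t ht
    have h1 : Tendsto (fun α => Tα α t (Rα α u)) atTop (𝓝 (T t w)) :=
      tendsto_apply_of_contraction
        (Eventually.of_forall fun α u => (hT α).norm_apply_le ht u) hw (hTl t ht w)
    refine (hw.sub (h1.const_smul (Real.exp (-(lam * t))))).congr fun α => ?_
    rw [(hT α).resolvent_apply_eq_laplace (hA α) hl (hRα α), (hT α).exp_smul_laplace hl ht,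
      sub_sub_cancel]
  refine hasGen_of_tendsto_exp ?_
  obtain ⟨α⟩ := ‹Nonempty J›
  rw [Metric.tendsto_nhdsWithin_nhds]
  intro ε hε
  have hc := (hT α).continuous_expOrbit lam u
  obtain ⟨δ, hδ, hδ'⟩ := Metric.continuousAt_iff.1 (hc.continuousAt (x := 0)) (ε / 4)
    (by positivity)
  refine ⟨δ, hδ, fun {t} (ht : 0 < t) htδ => ?_⟩
  rw [dist_zero_right, Real.norm_of_nonneg ht.le] at htδ
  -- The bound is independent of `β`, so it survives the limit that `hint` provides at fixed `t`.
  -- The factor `2` in `horbit` turns `ε / 4` into `ε / 2`.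
  have h1 : ∀ β, α ≤ β → ‖(∫ s in (0 : ℝ)..t, expOrbit (Tα β) lam u s) - t • u‖ ≤ ε / 2 * t := by
    intro β hβ
    have h2 : (∫ s in (0 : ℝ)..t, expOrbit (Tα β) lam u s) - t • u
        = ∫ s in (0 : ℝ)..t, (expOrbit (Tα β) lam u s - u) := by
      rw [intervalIntegral.integral_sub
        (((hT β).continuous_expOrbit lam u).intervalIntegrable _ _) (by simp)]
      simp
    rw [h2]
    refine (intervalIntegral.norm_integral_le_of_norm_le_const (C := ε / 2) fun s hs => ?_).trans_eq
      (by rw [sub_zero, abs_of_pos ht])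
    rw [Set.uIoc_of_le ht.le] at hs
    have h3 := hδ' (x := s) (by
      rw [dist_zero_right, Real.norm_of_nonneg hs.1.le]
      exact hs.2.trans_lt htδ)
    rw [expOrbit_zero, dist_eq_norm] at h3
    linarith [horbit α β hβ s hs.1]
  have h4 : ‖(w - Real.exp (-(lam * t)) • T t w) - t • u‖ ≤ ε / 2 * t := by
    refine le_of_tendsto ((hint t ht).sub_const (t • u)).norm ?_
    filter_upwards [eventually_ge_atTop α] with β hβ using h1 β hβ
  have h5 : t⁻¹ • (Real.exp (-(lam * t)) • T t w - w) - -u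
      = -(t⁻¹ • ((w - Real.exp (-(lam * t)) • T t w) - t • u)) := by
    rw [smul_sub t⁻¹ _ (t • u), smul_smul, inv_mul_cancel₀ ht.ne', one_smul,
      ← neg_sub w, smul_neg]
    abel
  rw [dist_eq_norm, h5, norm_neg, norm_smul, norm_inv, Real.norm_of_nonneg ht.le, inv_mul_eq_div,
    div_lt_iff₀ ht]
  nlinarith

/-- Kato's perturbation theorem by monotone regularisation, in an ordered Banach space whose norm
is additive on the positive cone. -/
theorem exists_semigroup_of_regularisation (htr : IsAdditiveNorm tr) {S : ℝ → X →L[ℝ] X}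
    {H : X →ₗ.[ℝ] X} (hS : IsContractionSemigroup S)
    (hSpos : ∀ t, 0 < t → ∀ u, 0 ≤ u → 0 ≤ S t u) (hH : IsGenerator S (-H))
    {K : H.domain →ₗ[ℝ] X} (hKH : ∀ u : H.domain, 0 ≤ (u : X) → tr (K u) ≤ tr (H u))
    {Kα : J → H.domain →ₗ[ℝ] X} (hKpos : ∀ α, ∀ u : H.domain, 0 ≤ (u : X) → 0 ≤ Kα α u)
    (hbound : ∀ α, ∃ a b : ℝ, 0 ≤ a ∧ 0 ≤ b ∧ b < 1 ∧ ∀ u : H.domain, 0 ≤ (u : X) →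
      tr (Kα α u) ≤ a * tr (u : X) + b * tr (H u))
    (hKmono : ∀ α β, α ≤ β → ∀ u : H.domain, 0 ≤ (u : X) → Kα α u ≤ Kα β u)
    (hKle : ∀ α, ∀ u : H.domain, 0 ≤ (u : X) → Kα α u ≤ K u)
    (hKlim : ∀ u : H.domain, 0 ≤ (u : X) → Tendsto (fun α => Kα α u) atTop (𝓝 (K u))) :
    ∃ Tα : J → ℝ → X →L[ℝ] X,
      (∀ α, IsMAccretive (subPert H (Kα α)) ∧ IsContractionSemigroup (Tα α) ∧
        (∀ t, 0 < t → ∀ u, 0 ≤ u → 0 ≤ Tα α t u) ∧ IsGenerator (Tα α) (-(subPert H (Kα α)))) ∧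
      (∀ α β, α ≤ β → ∀ t, 0 < t → ∀ u, 0 ≤ u → Tα α t u ≤ Tα β t u) ∧
      ∃ T : ℝ → X →L[ℝ] X,
        (∀ t, 0 < t → ∀ u, Tendsto (fun α => Tα α t u) atTop (𝓝 (T t u))) ∧
        IsContractionSemigroup T ∧ (∀ t, 0 < t → ∀ u, 0 ≤ u → 0 ≤ T t u) ∧
        ∃ L : X →ₗ.[ℝ] X, IsGenerator T (-L) ∧
          (∀ lam : ℝ, 0 < lam → ∃ (Rα : J → X →L[ℝ] X) (R : X →L[ℝ] X),
            (∀ α, IsResolvent (subPert H (Kα α)) lam (Rα α)) ∧ IsResolvent L lam R ∧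
            ∀ u, Tendsto (fun α => Rα α u) atTop (𝓝 (R u))) ∧
          subPert H K ≤ L := by
  have hres : ∀ α, ∀ lam : ℝ, ∃ R : X →L[ℝ] X, 0 < lam → IsResolvent (subPert H (Kα α)) lam R ∧
      (∀ u, 0 ≤ u → 0 ≤ R u) ∧ ∀ u, lam * ‖R u‖ ≤ ‖u‖ := by
    intro α lam
    by_cases hl : 0 < lam
    · obtain ⟨a, b, ha, hb, hb1, hab⟩ := hbound α
      obtain ⟨R, hR⟩ := hS.exists_resolvent_subPert htr hSpos hH (hKpos α)
        (fun u hu => (htr.mono (hKle α u hu)).trans (hKH u hu)) ha hb hb1 hab hl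
      exact ⟨R, fun _ => hR⟩
    · exact ⟨0, fun h => absurd h hl⟩
  choose R hR using hres
  have hRres := fun α lam hl => (hR α lam hl).1
  have hRpos := fun α lam hl => (hR α lam hl).2.1
  have hacc : ∀ α, IsMAccretive (subPert H (Kα α)) := fun α =>
    IsMAccretive.of_isResolvent fun lam hl => ⟨R α lam, hRres α lam hl, (hR α lam hl).2.2⟩
  have hRmono : ∀ lam, 0 < lam → ∀ α β, α ≤ β → ∀ u, 0 ≤ u → R α lam u ≤ R β lam u :=
    fun lam hl α β hab u hu => resolvent_subPert_mono (hRres α lam hl) (hRres β lam hl)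
      (hRpos α lam hl) (hRpos β lam hl) (hKmono α β hab) hu
  have hdense : Dense (H.domain : Set X) := hS.dense_domain hH
  have hsg := fun α => (hacc α).exists_semigroup hdense (hRres α)
  choose Tα hTα hgen hlim using hsg
  have hpos : ∀ α t, 0 < t → ∀ u, 0 ≤ u → 0 ≤ Tα α t u := by
    intro α t ht u hu
    refine ge_of_tendsto (hlim α t ht u) ?_
    filter_upwards [eventually_gt_atTop 0] with lam hl
    exact exp_yosida_apply_nonneg (hRpos α lam hl) ht.le hu
  have hmono : ∀ α β, α ≤ β → ∀ t, 0 < t → ∀ u, 0 ≤ u → Tα α t u ≤ Tα β t u := by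
    intro α β hab t ht u hu
    refine le_of_tendsto_of_tendsto (hlim α t ht u) (hlim β t ht u) ?_
    filter_upwards [eventually_gt_atTop 0] with lam hl
    exact exp_yosida_apply_mono (hRpos α lam hl) (hRmono lam hl α β hab) ht.le hu
  obtain ⟨T, hTl, hT, hTpos⟩ := exists_semigroup_of_monotone htr hTα hpos hmono
  obtain ⟨A, hA⟩ := exists_isGenerator T
  have hL : IsGenerator T (-(-A)) := by rwa [neg_neg]
  have hconv : ∀ lam : ℝ, 0 < lam → ∃ R' : X →L[ℝ] X, IsResolvent (-A) lam R' ∧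
      ∀ u, Tendsto (fun α => R α lam u) atTop (𝓝 (R' u)) := by
    intro lam hl
    obtain ⟨R', hR', -⟩ := (hT.isMAccretive hL).exists_isResolvent hl
    exact ⟨R', hR', tendsto_resolvent_of_monotone htr hTα hpos hmono hTl hgen hL hl
      (fun α => hRres α lam hl) hR' (fun α => hRpos α lam hl) (hRmono lam hl)⟩
  refine ⟨Tα, fun α => ⟨hacc α, hTα α, hpos α, hgen α⟩, hmono, T, hTl, hT, hTpos, -A, hL,
    fun lam hl => ?_, ?_⟩
  · obtain ⟨R', hR', hlim'⟩ := hconv lam hl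
    exact ⟨fun α => R α lam, R', fun α => hRres α lam hl, hR', hlim'⟩
  · refine LinearPMap.le_of_le_graph ?_
    rintro ⟨x, y⟩ hxy
    obtain ⟨w, rfl, rfl⟩ := (LinearPMap.mem_graph_iff _).1 hxy
    obtain ⟨R', hR', hlim'⟩ := hconv 1 one_pos
    -- The resolvents at `λ = 1` are contractions, so they may be applied to this convergent net.
    -- This yields `w = (I + L)⁻¹ (I + H - K) w`, hence `w ∈ D(L)`.
    have h1 : Tendsto (fun α => (1 : ℝ) • (w : X) + subPert H (Kα α) w) atTop
        (𝓝 ((1 : ℝ) • (w : X) + subPert H K w)) :=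
      ((hS.tendsto_of_nonneg_domain htr hSpos hH hKlim w).const_sub (H w)).const_add _
    have h2 := tendsto_apply_of_contraction (F := fun α => R α 1)
      (Eventually.of_forall fun α u => by simpa using (hR α 1 one_pos).2.2 u) h1 (hlim' _)
    have h3 : (w : X) = R' ((1 : ℝ) • (w : X) + subPert H K w) :=
      tendsto_nhds_unique (tendsto_const_nhds.congr fun α => ((hRres α 1 one_pos).2 w).symm) h2
    obtain ⟨x, hx, hx'⟩ := hR'.1 ((1 : ℝ) • (w : X) + subPert H K w)
    rw [← h3] at hx
    rw [hx, add_right_inj] at hx'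
    exact (LinearPMap.mem_graph_iff _).2 ⟨x, hx, hx'⟩

end MonotoneLimits

/-! ### The self-adjoint trace class as an ordered Banach space -/

section TraceClassSpace

variable {h : Type*} [NormedAddCommGroup h] [InnerProductSpace ℂ h] [CompleteSpace h]

namespace TraceClassSA

theorem toCLM_injective : Function.Injective (toCLM : TraceClassSA h → h →L[ℂ] h) :=
  Subtype.val_injective

theorem toCLM_add (u v : TraceClassSA h) : (u + v).toCLM = u.toCLM + v.toCLM := rfl

theorem toCLM_sub (u v : TraceClassSA h) : (u - v).toCLM = u.toCLM - v.toCLM := rfl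

theorem toCLM_smul (r : ℝ) (u : TraceClassSA h) : (r • u).toCLM = r • u.toCLM := rfl

/-! ### The order -/

instance : PartialOrder (TraceClassSA h) := PartialOrder.lift toCLM toCLM_injective

theorem nonneg_iff {u : TraceClassSA h} : 0 ≤ u ↔ 0 ≤ u.toCLM := Iff.rfl

theorem isPos_iff_nonneg {u : TraceClassSA h} : IsPos u ↔ 0 ≤ u :=
  (ContinuousLinearMap.nonneg_iff_isPositive _).symm

instance : IsOrderedAddMonoid (TraceClassSA h) where
  add_le_add_left _ _ huv w := add_le_add_left (α := h →L[ℂ] h) huv w.toCLM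

instance : IsOrderedModule ℝ (TraceClassSA h) := by
  refine IsOrderedModule.of_smul_nonneg fun r hr u hu => ?_
  rw [nonneg_iff, toCLM_smul, ContinuousLinearMap.nonneg_iff_isPositive]
  have h1 := ((ContinuousLinearMap.nonneg_iff_isPositive _).1 (nonneg_iff.1 hu)).smul_of_nonneg
    (c := (r : ℂ)) (by exact_mod_cast hr)
  exact h1

/-! ### The trace norm dominates the operator norm -/

theorem toReal_posTrace_of_nonneg {u : TraceClassSA h} (hu : 0 ≤ u) :
    (posTrace u.toCLM).toReal = trace u := by
  have h1 : posTrace u.toCLM < ∞ := by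
    have := u.isTraceClass
    rwa [IsTraceClass, CFC.abs_of_nonneg u.toCLM (nonneg_iff.1 hu)] at this
  exact (hasSum_traceAlong (stdBasis h) (nonneg_iff.1 hu) h1).unique (hasSum_trace _ u)

theorem norm_eq_trace {u : TraceClassSA h} (hu : 0 ≤ u) : ‖u‖ = trace u := by
  rw [norm_def, CFC.abs_of_nonneg u.toCLM (nonneg_iff.1 hu), toReal_posTrace_of_nonneg hu]

/-- With `s` the positive square root of `|u|`, Parseval and Cauchy–Schwarz give `‖s x‖² ≤ ∑ ‖s bᵢ‖²
‖x‖² = ‖u‖ ‖x‖²`, and `|u| = s²`. -/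
theorem norm_toCLM_le (u : TraceClassSA h) : ‖u.toCLM‖ ≤ ‖u‖ := by
  obtain ⟨s, hs, hss, hn⟩ := exists_sqrt (CFC.abs_nonneg u.toCLM)
  have h1 : ‖s‖ ≤ Real.sqrt ‖u‖ := by
    refine s.opNorm_le_bound (Real.sqrt_nonneg _) fun x => ?_
    refine Real.le_sqrt_of_sq_le ?_ |>.trans_eq (Real.sqrt_mul (norm_nonneg u) (‖x‖ ^ 2)) |>.trans_eq
      (by rw [Real.sqrt_sq (norm_nonneg x)])
    have h2 : ENNReal.ofReal (‖s x‖ ^ 2) ≤ posTrace (CFC.abs u.toCLM) * ENNReal.ofReal (‖x‖ ^ 2) := by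
      rw [parseval (stdBasis h) (s x), posTrace, traceAlong, ← ENNReal.tsum_mul_right]
      refine ENNReal.tsum_le_tsum fun i => ?_
      rw [hn, ← ENNReal.ofReal_mul (by positivity), ← hs, ← mul_pow]
      exact ENNReal.ofReal_le_ofReal (pow_le_pow_left₀ (norm_nonneg _) (norm_inner_le_norm _ _) 2)
    have h3 := ENNReal.toReal_mono (ENNReal.mul_ne_top u.isTraceClass.ne ENNReal.ofReal_ne_top) h2
    rwa [ENNReal.toReal_mul, ENNReal.toReal_ofReal (by positivity),
      ENNReal.toReal_ofReal (by positivity)] at h3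
  rw [← CFC.norm_abs, hss]
  calc ‖s * s‖ ≤ ‖s‖ * ‖s‖ := norm_mul_le _ _
    _ ≤ Real.sqrt ‖u‖ * Real.sqrt ‖u‖ := by gcongr
    _ = ‖u‖ := Real.mul_self_sqrt (norm_nonneg u)

variable (h) in
/-- The embedding of the trace class into the bounded operators. -/
def toCLML : TraceClassSA h →L[ℝ] (h →L[ℂ] h) :=
  LinearMap.mkContinuous
    { toFun := toCLM
      map_add' := toCLM_add
      map_smul' := toCLM_smul } 1 fun u => by rw [one_mul]; exact norm_toCLM_le u

theorem continuous_toCLM : Continuous (toCLM : TraceClassSA h → h →L[ℂ] h) :=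
  (toCLML h).continuous

instance : OrderClosedTopology (TraceClassSA h) where
  isClosed_le' := isClosed_le (α := h →L[ℂ] h) (continuous_toCLM.comp continuous_fst)
    (continuous_toCLM.comp continuous_snd)

/-! ### Completeness -/

theorem sum_abs_inner_le {ι : Type*} (b : HilbertBasis ι ℂ h) (u : TraceClassSA h) (s : Finset ι) :
    ∑ i ∈ s, |(inner ℂ (b i) (u.toCLM (b i))).re| ≤ ‖u‖ := by
  have h1 := hasSum_traceAlong b (CFC.abs_nonneg u.toCLM) u.isTraceClass
  rw [norm_def]
  calc ∑ i ∈ s, |(inner ℂ (b i) (u.toCLM (b i))).re|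
      ≤ ∑ i ∈ s, (inner ℂ (b i) (CFC.abs u.toCLM (b i))).re :=
        Finset.sum_le_sum fun i _ => abs_inner_re_le u.isSelfAdjoint (b i)
    _ ≤ (posTrace (CFC.abs u.toCLM)).toReal :=
        sum_le_hasSum s (fun i _ => inner_re_nonneg (CFC.abs_nonneg u.toCLM) (b i)) h1

/-- A self-adjoint operator whose diagonal sums are bounded by `C` is of trace class, with trace
norm at most `C`. -/
theorem posTrace_abs_le {a : h →L[ℂ] h} (ha : IsSelfAdjoint a) {C : ℝ}
    (hC : ∀ (w : Set h) (b : HilbertBasis w ℂ h) (s : Finset w),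
      ∑ i ∈ s, |(inner ℂ (b i) (a (b i))).re| ≤ C) :
    posTrace (CFC.abs a) ≤ ENNReal.ofReal C := by
  -- On this basis the diagonal of `|a|` is the absolute value of the diagonal of `a`.
  obtain ⟨w, b, hb⟩ := exists_adapted_basis a
  have h1 : ∀ i, (inner ℂ (b i) (CFC.abs a (b i))).re = |(inner ℂ (b i) (a (b i))).re| := by
    intro i
    have e1 : CFC.abs a = a⁺ + a⁻ := (CFC.posPart_add_negPart a ha).symm
    have e2 : a = a⁺ - a⁻ := (CFC.posPart_sub_negPart a ha).symm
    have e3 : (inner ℂ (b i) (CFC.abs a (b i))).re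
        = (inner ℂ (b i) (a⁺ (b i))).re + (inner ℂ (b i) (a⁻ (b i))).re := by
      rw [e1]; simp
    have e4 : (inner ℂ (b i) (a (b i))).re
        = (inner ℂ (b i) (a⁺ (b i))).re - (inner ℂ (b i) (a⁻ (b i))).re := by
      conv_lhs => rw [e2]
      simp
    have hp := inner_re_nonneg (CFC.posPart_nonneg a) (b i)
    have hm := inner_re_nonneg (CFC.negPart_nonneg a) (b i)
    rw [e3, e4]
    rcases hb i with hi | hi
    · simp only [hi, inner_zero_right, Complex.zero_re, zero_add, zero_sub, abs_neg,
        abs_of_nonneg hm]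
    · simp only [hi, inner_zero_right, Complex.zero_re, add_zero, sub_zero, abs_of_nonneg hp]
  rw [posTrace, traceAlong_eq _ b (CFC.abs_nonneg _), traceAlong, ENNReal.tsum_eq_iSup_sum]
  refine iSup_le fun s => ?_
  rw [← ENNReal.ofReal_sum_of_nonneg fun i _ => inner_re_nonneg (CFC.abs_nonneg a) _]
  refine ENNReal.ofReal_le_ofReal ?_
  simp_rw [h1]
  exact hC w b s

instance : CompleteSpace (TraceClassSA h) := by
  refine Metric.complete_of_cauchySeq_tendsto fun u hu => ?_
  obtain ⟨a, ha⟩ := cauchySeq_tendsto_of_complete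
    ((toCLML h).uniformContinuous.comp_cauchySeq hu)
  have hsa : IsSelfAdjoint a :=
    tendsto_nhds_unique (((continuous_star.tendsto a).comp ha).congr fun n =>
      (u n).isSelfAdjoint.star_eq) ha
  -- Lower semicontinuity of the trace norm under operator-norm limits: finite diagonal sums are
  -- continuous in the operator norm, and their bounds control the trace norm.
  have key : ∀ (v : TraceClassSA h) (C : ℝ), (∀ᶠ n in atTop, ‖u n - v‖ ≤ C) →
      posTrace (CFC.abs (a - v.toCLM)) ≤ ENNReal.ofReal C := by
    intro v C hC
    refine posTrace_abs_le (hsa.sub v.isSelfAdjoint) fun w b s => ?_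
    have h1 : Tendsto (fun n => ∑ i ∈ s, |(inner ℂ (b i) ((u n - v).toCLM (b i))).re|) atTop
        (𝓝 (∑ i ∈ s, |(inner ℂ (b i) ((a - v.toCLM) (b i))).re|)) := by
      have h2 : Continuous fun c : h →L[ℂ] h =>
          ∑ i ∈ s, |(inner ℂ (b i) ((c - v.toCLM) (b i))).re| := by fun_prop
      exact (h2.tendsto a).comp ha
    refine le_of_tendsto h1 ?_
    filter_upwards [hC] with n hn
    exact (sum_abs_inner_le b _ s).trans hn
  have hbd : ∀ ε > 0, ∃ N, ∀ m ≥ N, ∀ᶠ n in atTop, ‖u n - u m‖ ≤ ε := by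
    intro ε hε
    obtain ⟨N, hN⟩ := Metric.cauchySeq_iff.1 hu ε hε
    refine ⟨N, fun m hm => ?_⟩
    filter_upwards [eventually_ge_atTop N] with n hn
    rw [← dist_eq_norm]
    exact (hN n hn m hm).le
  obtain ⟨N, hN⟩ := hbd 1 one_pos
  have htc : IsTraceClass (a - (u N).toCLM) :=
    (key (u N) 1 (hN N le_rfl)).trans_lt ENNReal.ofReal_lt_top
  let d : TraceClassSA h := ⟨a - (u N).toCLM, hsa.sub (u N).isSelfAdjoint, htc⟩
  have hd : (d + u N).toCLM = a := by
    rw [toCLM_add]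
    exact sub_add_cancel a (u N).toCLM
  refine ⟨d + u N, ?_⟩
  rw [Metric.tendsto_atTop]
  intro ε hε
  obtain ⟨M, hM⟩ := hbd (ε / 2) (by positivity)
  refine ⟨M, fun m hm => ?_⟩
  have h1 := key (u m) (ε / 2) (hM m hm)
  rw [dist_comm, dist_eq_norm, norm_def, toCLM_sub, hd]
  have h2 := ENNReal.toReal_mono ENNReal.ofReal_ne_top h1
  rw [ENNReal.toReal_ofReal (by positivity)] at h2
  linarith

/-! ### The trace -/

theorem abs_trace_le (u : TraceClassSA h) : |trace u| ≤ ‖u‖ := by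
  have h1 := hasSum_trace (stdBasis h) u
  refine le_of_tendsto (h1.abs) (Eventually.of_forall fun s => ?_)
  exact (Finset.abs_sum_le_sum_abs _ _).trans (sum_abs_inner_le _ u s)

variable (h) in
/-- The trace as a bounded linear functional. -/
def traceCLM : TraceClassSA h →L[ℝ] ℝ :=
  LinearMap.mkContinuous
    { toFun := trace
      map_add' := fun u v => (hasSum_trace (stdBasis h) (u + v)).unique (by
        simpa [toCLM_add, inner_add_right] using
          (hasSum_trace (stdBasis h) u).add (hasSum_trace (stdBasis h) v))
      map_smul' := fun r u => (hasSum_trace (stdBasis h) (r • u)).unique (by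
        simpa [toCLM_smul, inner_smul_right_eq_smul] using
          (hasSum_trace (stdBasis h) u).mul_left r) } 1
    fun u => by rw [one_mul]; exact abs_trace_le u

/-- The decomposition is `u = u⁺ - u⁻`; since `|u| = u⁺ + u⁻`, the trace norms add up exactly. -/
theorem isAdditiveNorm_traceCLM : IsAdditiveNorm (traceCLM h) where
  norm_eq u hu := norm_eq_trace hu
  exists_decomp u := by
    set a := u.toCLM with ha
    have h1 : CFC.abs a = a⁺ + a⁻ := (CFC.posPart_add_negPart a u.isSelfAdjoint).symm
    have h2 : a⁺ - a⁻ = a := CFC.posPart_sub_negPart a u.isSelfAdjoint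
    have hp := CFC.posPart_nonneg a
    have hm := CFC.negPart_nonneg a
    have h3 : posTrace (CFC.abs a) = posTrace a⁺ + posTrace a⁻ := by
      rw [posTrace, h1, traceAlong_add _ hp hm]
      rfl
    have h4 : posTrace a⁺ + posTrace a⁻ < ∞ := h3 ▸ u.isTraceClass
    rw [ENNReal.add_lt_top] at h4
    have hpt : IsTraceClass a⁺ := by
      rw [IsTraceClass, CFC.abs_of_nonneg _ hp]
      exact h4.1
    have hmt : IsTraceClass a⁻ := by
      rw [IsTraceClass, CFC.abs_of_nonneg _ hm]
      exact h4.2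
    let p : TraceClassSA h := ⟨a⁺, IsSelfAdjoint.of_nonneg hp, hpt⟩
    let q : TraceClassSA h := ⟨a⁻, IsSelfAdjoint.of_nonneg hm, hmt⟩
    have hpa : p.toCLM = a⁺ := rfl
    have hqa : q.toCLM = a⁻ := rfl
    refine ⟨p, q, hp, hm, toCLM_injective h2.symm, ?_⟩
    rw [norm_def, norm_def, norm_def, hpa, hqa, CFC.abs_of_nonneg _ hp, CFC.abs_of_nonneg _ hm, h3,
      ENNReal.toReal_add h4.1.ne h4.2.ne]

end TraceClassSA

end TraceClassSpace

/-! ### From weak to trace-norm convergence of the regularisation -/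

section Regularisation

variable {h : Type*} [NormedAddCommGroup h] [InnerProductSpace ℂ h] [CompleteSpace h]
  {J : Type*} [Preorder J] [IsDirectedOrder J] [Nonempty J]

/-- A bounded operator is determined by its quadratic form on a dense subspace. -/
theorem eq_of_inner_self_eq_of_dense {a b : h →L[ℂ] h} {V : Set h} (hV : Dense V)
    (hab : ∀ x ∈ V, inner ℂ (a x) x = inner ℂ (b x) x) : a = b := by
  have h1 : (fun x => inner ℂ (a x) x) = fun x => inner ℂ (b x) x :=
    Continuous.ext_on hV (by fun_prop) (by fun_prop) hab
  -- Polarisation over `ℂ`: the quadratic form determines the operator.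
  exact ContinuousLinearMap.coe_injective
    ((ext_inner_map a.toLinearMap b.toLinearMap).1 fun x => congrFun h1 x)

/-- The weak convergence of a functional regularisation is convergence in trace norm. -/
theorem IsFunctionalRegularisation.tendsto_norm {H : TraceClassSA h →ₗ.[ℝ] TraceClassSA h}
    {K : H.domain →ₗ[ℝ] TraceClassSA h} {Kα : J → H.domain →ₗ[ℝ] TraceClassSA h}
    (hK : IsFunctionalRegularisation H K Kα) (u : H.domain) (hu : 0 ≤ (u : TraceClassSA h)) :
    Tendsto (fun α => Kα α u) atTop (𝓝 (K u)) := by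
  have hpos := TraceClassSA.isPos_iff_nonneg.2 hu
  have hmono : Monotone fun α => Kα α u := fun α β hab =>
    sub_nonneg.1 (TraceClassSA.isPos_iff_nonneg.1 ((hK.mono α β hab).1 u hpos))
  have hle : ∀ α, Kα α u ≤ K u := fun α =>
    sub_nonneg.1 (TraceClassSA.isPos_iff_nonneg.1 ((hK.mono α α le_rfl).2 u hpos))
  have htr := TraceClassSA.isAdditiveNorm_traceCLM (h := h)
  obtain ⟨v, hv⟩ := htr.exists_tendsto_of_monotone hmono fun α => htr.mono (hle α)
  obtain ⟨V, hV, hVlim⟩ := hK.tendsto u hpos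
  -- The norm limit exists by monotonicity; condition (IV) serves only to identify it.
  have h1 : v = K u := by
    refine TraceClassSA.toCLM_injective (eq_of_inner_self_eq_of_dense hV fun x hx => ?_)
    have hc : Continuous fun a : h →L[ℂ] h => inner ℂ (a x) x := by fun_prop
    exact tendsto_nhds_unique
      (((hc.comp TraceClassSA.continuous_toCLM).tendsto v).comp hv) (hVlim x hx)
  rwa [← h1]

end Regularisation

end KatoReg

end

/-! ### The theorem on the trace class -/

open KatoReg in
theorem theorem2p5 {h : Type*} [NormedAddCommGroup h] [InnerProductSpace ℂ h] [CompleteSpace h]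
    {J : Type*} [Preorder J] [IsDirectedOrder J] [Nonempty J]
    (S : ℝ → TraceClassSA h →L[ℝ] TraceClassSA h)
    (H : TraceClassSA h →ₗ.[ℝ] TraceClassSA h)
    (hS : IsDynamicalSemigroup S) (hH : IsGenerator S (-H))
    (K : H.domain →ₗ[ℝ] TraceClassSA h) (hK : PosPreserving K)
    (hKH : ∀ u : H.domain, IsPos (u : TraceClassSA h) → trace (K u) ≤ trace (H u))
    (Kα : J → H.domain →ₗ[ℝ] TraceClassSA h)
    (hKα : IsFunctionalRegularisation H K Kα) :
    ∃ Tα : J → ℝ → TraceClassSA h →L[ℝ] TraceClassSA h,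
      (∀ α, IsMAccretive (subPert H (Kα α)) ∧ IsDynamicalSemigroup (Tα α) ∧
        IsGenerator (Tα α) (-(subPert H (Kα α)))) ∧
      (∀ α β, α ≤ β → ∀ t, 0 < t → PosPreservingCLM (Tα β t - Tα α t)) ∧
      ∃ T : ℝ → TraceClassSA h →L[ℝ] TraceClassSA h,
        (∀ t, 0 < t → ∀ u, Tendsto (fun α => Tα α t u) atTop (𝓝 (T t u))) ∧
        IsDynamicalSemigroup T ∧
        ∃ L : TraceClassSA h →ₗ.[ℝ] TraceClassSA h,
          IsGenerator T (-L) ∧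
          (∀ lam : ℝ, 0 < lam →
            ∃ (Rα : J → TraceClassSA h →L[ℝ] TraceClassSA h)
              (R : TraceClassSA h →L[ℝ] TraceClassSA h),
              (∀ α, IsResolvent (subPert H (Kα α)) lam (Rα α)) ∧ IsResolvent L lam R ∧
              ∀ u, Tendsto (fun α => Rα α u) atTop (𝓝 (R u))) ∧
          subPert H K ≤ L := by
  have hpos : ∀ {T : ℝ → TraceClassSA h →L[ℝ] TraceClassSA h} {t : ℝ},
      PosPreservingCLM (T t) ↔ ∀ u, 0 ≤ u → 0 ≤ T t u := by
    simp only [PosPreservingCLM, TraceClassSA.isPos_iff_nonneg, implies_true]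
  obtain ⟨Tα, hTα, hmono, T, hTl, hT, hTpos, L, hL, hres, hle⟩ :=
    exists_semigroup_of_regularisation (J := J) TraceClassSA.isAdditiveNorm_traceCLM
      ⟨hS.c0, hS.contraction⟩ (fun t ht => hpos.1 (hS.pos t ht)) hH
      (fun u hu => hKH u (TraceClassSA.isPos_iff_nonneg.2 hu))
      (fun α u hu => TraceClassSA.isPos_iff_nonneg.1
        (hKα.pos α u (TraceClassSA.isPos_iff_nonneg.2 hu)))
      (fun α => by
        obtain ⟨a, b, ha, hb, hb1, hab⟩ := hKα.bound α
        exact ⟨a, b, ha, hb, hb1, fun u hu => hab u (TraceClassSA.isPos_iff_nonneg.2 hu)⟩)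
      (fun α β hab u hu => sub_nonneg.1 (TraceClassSA.isPos_iff_nonneg.1
        ((hKα.mono α β hab).1 u (TraceClassSA.isPos_iff_nonneg.2 hu))))
      (fun α u hu => sub_nonneg.1 (TraceClassSA.isPos_iff_nonneg.1
        ((hKα.mono α α le_rfl).2 u (TraceClassSA.isPos_iff_nonneg.2 hu))))
      hKα.tendsto_norm
  refine ⟨Tα, fun α => ⟨(hTα α).1, ⟨(hTα α).2.1.c0, (hTα α).2.1.contraction,
    fun t ht => hpos.2 ((hTα α).2.2.1 t ht)⟩, (hTα α).2.2.2⟩, fun α β hab t ht u hu => ?_, T, hTl,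
    ⟨hT.c0, hT.contraction, fun t ht => hpos.2 (hTpos t ht)⟩, L, hL, hres, hle⟩
  exact TraceClassSA.isPos_iff_nonneg.2
    (sub_nonneg.2 (hmono α β hab t ht u (TraceClassSA.isPos_iff_nonneg.1 hu)))
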